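/- Let $\rho,\kappa:\mathbb R\to\mathbb R$ be measurable and $V_0:\mathbb R\to\mathbb R$ smooth, with $\rho\ge 0$ and $\operatorname{supp}\kappa\subset\operatorname{supp}\rho$. Put $\hat a=\kappa/\sqrt\rho$ (equal to $0$ where $\rho=0$), $\hat w(\nu)=2\pi\hat a^2(\nu)/(i\nu)$, $K=\int_{\mathbb R}\frac{\kappa^2}{\rho\nu^2}\,d\nu$ and $V(x)=V_0(x)-\tfrac12Kx^2$. Let $\widehat{\mathcal M}$ be the set of Fourier transforms $\lambda\mapsto\int e^{-i\lambda\tau}\,d\mu(\tau)$ of finite complex Borel measures $\mu$ on $\mathbb R$. Assume the following. (1) $\int\frac{\kappa^2}{\rho}\,d\nu$ and $K$ are finite. (2) $V$ is bounded from below, $V(x)\to\infty$ as $|x|\to\infty$, and the sets $\{V\le E\}$ are compact. (3) The initial data $\xi_0,\xi_1:\mathbb R\to\mathbb R$ are measurable and satisfy $\int\rho\,(\xi_1^2+\nu^2\xi_0^2)\,d\nu<\infty$. (4) $\hat a$ and $\hat a'$ belong to $\widehat{\mathcal M}$, $\hat a(0)=0$, and $\hat w(0)=0$ (in the sense $\lim_{\nu\to0}\hat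 w(\nu)=0$). (5) For $\nu_0=0$: $\hat a$ vanishes for $|\nu|\le\nu_0$ and is positive for $|\nu|>\nu_0$, so that $\sigma:=\{\hat a\ne0\}=\{|\nu|>\nu_0\}=\mathbb R\setminus\{0\}$. Moreover, let $w(\tau)=\frac1{2\pi}\int e^{i\lambda\tau}\hat w(\lambda)\,d\lambda$, let $w_\diamond^\pm(\tau)=\pm\frac12(w(\tau)-w(-\tau))$ for $\pm\tau>0$ and $w_\diamond^\pm(\tau)=0$ otherwise, and let $\hat w_\diamond^\pm(\nu)=\int e^{-i\nu\tau}w_\diamond^\pm(\tau)\,d\tau$. The functions $\hat w^\pm_\diamond$ restricted to $[-\nu_0,\nu_0]$ coincide, are real and even, and are increasing on $[0,\nu_0]$. (6) The set of critical points of $V$ contains no interval of positive length. Let $x(t)$, $\xi(\nu,t)$, $t\in\mathbb R$, be a solution of $$\ddot x+V_0'(x)=\int_{\mathbb R}\kappa(\nu)\,\xi(\nu,t)\,d\nu,\qquad \rho(\nu)\big(\ddot\xi+\nu^2\xi\big)=\kappa(\nu)\,x\quad\text{for almost every }\nu,$$ with $x(0)=x_0$, $\dot x(0)=x_1$, $\xi(\nu,0)=\xi_0(\nu)$,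 $\dot\xi(\nu,0)=\xi_1(\nu)$, where $x_0,x_1\in\mathbb R$ are arbitrary. Then the limits $x_\pm=\lim_{t\to\pm\infty}x(t)$ exist, and $x_+$ and $x_-$ are critical points of $V$, i.e. $V_0'(x_\pm)=Kx_\pm$. -/

import Mathlib

open MeasureTheory Filter Topology
open scoped ContDiff

noncomputable section

namespace Thermostat

/-- The amplitude `â = κ / √ρ`; division by zero makes it vanish where `ρ` does. -/
def aHat (ρ κ : ℝ → ℝ) (ν : ℝ) : ℝ := κ ν / Real.sqrt (ρ ν)

/-- The function `ŵ(ν) = 2π â(ν)² / (iν)`. -/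
def wHat (ρ κ : ℝ → ℝ) (ν : ℝ) : ℂ :=
  2 * (Real.pi : ℂ) * (aHat ρ κ ν : ℂ) ^ 2 / (Complex.I * (ν : ℂ))

/-- The Fourier transform `∫ e^{-iλτ} g(τ) dτ`. -/
def fourier (g : ℝ → ℂ) (l : ℝ) : ℂ :=
  ∫ τ : ℝ, Complex.exp (-(Complex.I * l * τ)) * g τ

/-- The inverse Fourier transform `(2π)⁻¹ ∫ e^{iλτ} g(λ) dλ`. -/
def fourierInv (g : ℝ → ℂ) (τ : ℝ) : ℂ :=
  (2 * (Real.pi : ℂ))⁻¹ * ∫ l : ℝ, Complex.exp (Complex.I * l * τ) * g l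

/-- The inverse Fourier transform `w` of `ŵ`. -/
def w (ρ κ : ℝ → ℝ) : ℝ → ℂ := fourierInv (wHat ρ κ)

/-- The function `w_⋄^s`, for the sign `s = 1` or `s = -1`. -/
def wDiamond (ρ κ : ℝ → ℝ) (s : ℝ) (τ : ℝ) : ℂ :=
  if 0 < s * τ then (s : ℂ) * (w ρ κ τ - w ρ κ (-τ)) / 2 else 0

/-- The Fourier transform of `w_⋄^s`, for the sign `s = 1` or `s = -1`. -/
def wDiamondHat (ρ κ : ℝ → ℝ) (s : ℝ) : ℝ → ℂ := fourier (wDiamond ρ κ s)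

/-- The Fourier transform of a measure on the line. -/
def fourierMeasure (μ : Measure ℝ) (l : ℝ) : ℂ :=
  ∫ τ : ℝ, Complex.exp (-(Complex.I * l * τ)) ∂μ

/-- `g` is the Fourier transform of a finite complex Radon measure, the latter being written as
`μ₁ - μ₂ + iμ₃ - iμ₄` with finite non-negative measures `μⱼ`. -/
def IsFourierOfMeasure (g : ℝ → ℂ) : Prop :=
  ∃ μ₁ μ₂ μ₃ μ₄ : Measure ℝ, IsFiniteMeasure μ₁ ∧ IsFiniteMeasure μ₂ ∧
    IsFiniteMeasure μ₃ ∧ IsFiniteMeasure μ₄ ∧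
    ∀ l : ℝ, g l = fourierMeasure μ₁ l - fourierMeasure μ₂ l
      + Complex.I * fourierMeasure μ₃ l - Complex.I * fourierMeasure μ₄ l

/-- The essential spectrum `σ = {s : â(s) ≠ 0}`. -/
def spectrum (ρ κ : ℝ → ℝ) : Set ℝ := {s | aHat ρ κ s ≠ 0}

/-- The constant `K = ∫ κ² / (ρν²) dν`. -/
def K (ρ κ : ℝ → ℝ) : ℝ := ∫ ν : ℝ, κ ν ^ 2 / (ρ ν * ν ^ 2)

/-- The effective potential `V(x) = V₀(x) - K x² / 2`. -/
def effectivePotential (ρ κ V₀ : ℝ → ℝ) (y : ℝ) : ℝ := V₀ y - K ρ κ * y ^ 2 / 2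

/-- Regularity: `V₀` is smooth, `ρ ≥ 0`, `supp κ ⊆ supp ρ`. -/
structure H1 (ρ κ V₀ : ℝ → ℝ) : Prop where
  smooth : ContDiff ℝ ∞ V₀
  aemeasurable_density : AEMeasurable ρ volume
  aemeasurable_coupling : AEMeasurable κ volume
  density_nonneg : ∀ ν, 0 ≤ ρ ν
  supp_subset : tsupport κ ⊆ tsupport ρ

/-- The integrals `∫ κ²/ρ` and `∫ κ²/(ρν²)` are finite. The integrand `κ²/ρ` counts as infinite
where `ρ` vanishes and `κ` does not, so this may happen only on a null set. -/
structure H2 (ρ κ : ℝ → ℝ) : Prop where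
  null : ∀ᵐ ν : ℝ, ρ ν = 0 → κ ν = 0
  integrable : Integrable (fun ν : ℝ => κ ν ^ 2 / ρ ν)
  integrable_K : Integrable (fun ν : ℝ => κ ν ^ 2 / (ρ ν * ν ^ 2))

/-- The effective potential is bounded from below and tends to infinity as `|x| → ∞`, and its
sublevel sets are compact. -/
structure H3 (ρ κ V₀ : ℝ → ℝ) : Prop where
  bddBelow : BddBelow (Set.range (effectivePotential ρ κ V₀))
  coercive : Tendsto (effectivePotential ρ κ V₀) (cocompact ℝ) atTop
  compact : ∀ E : ℝ, IsCompact {y : ℝ | effectivePotential ρ κ V₀ y ≤ E}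

/-- The initial state `ξ|_{t=0} = ξ₀`, `ξ'|_{t=0} = ξ₁` of the thermostat has finite energy. -/
structure H4 (ρ ξ₀ ξ₁ : ℝ → ℝ) : Prop where
  aemeasurable_pos : AEMeasurable ξ₀ volume
  aemeasurable_vel : AEMeasurable ξ₁ volume
  integrable : Integrable (fun ν : ℝ => ρ ν * (ξ₁ ν ^ 2 + ν ^ 2 * ξ₀ ν ^ 2))

/-- `â` and `â'` are Fourier transforms of finite complex measures, `â(0) = 0`, and
`ŵ(0) = 0`, where `ŵ(0)` is the limit of `ŵ(ν)` as `ν → 0`. -/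
structure H5 (ρ κ : ℝ → ℝ) : Prop where
  differentiable : Differentiable ℝ (aHat ρ κ)
  aHat_mem : IsFourierOfMeasure (fun ν => ((aHat ρ κ ν : ℝ) : ℂ))
  deriv_mem : IsFourierOfMeasure (fun ν => ((deriv (aHat ρ κ) ν : ℝ) : ℂ))
  aHat_zero : aHat ρ κ 0 = 0
  wHat_zero : Tendsto (wHat ρ κ) (𝓝[≠] 0) (𝓝 0)

/-- The hypothesis on the thermostat, with the threshold frequency `ν₀`. -/
structure T (ρ κ : ℝ → ℝ) (ν₀ : ℝ) : Prop where
  threshold_nonneg : 0 ≤ ν₀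
  aHat_eq_zero : ∀ ν, |ν| ≤ ν₀ → aHat ρ κ ν = 0
  aHat_pos : ∀ ν, ν₀ < |ν| → 0 < aHat ρ κ ν
  spectrum_eq : spectrum ρ κ = {ν | ν₀ < |ν|}
  diamond_eq : ∀ ν ∈ Set.Icc (-ν₀) ν₀, wDiamondHat ρ κ 1 ν = wDiamondHat ρ κ (-1) ν
  diamond_real : ∀ ν ∈ Set.Icc (-ν₀) ν₀, (wDiamondHat ρ κ 1 ν).im = 0
  diamond_even : ∀ ν ∈ Set.Icc (-ν₀) ν₀, wDiamondHat ρ κ 1 (-ν) = wDiamondHat ρ κ 1 ν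
  diamond_mono : StrictMonoOn (fun ν => (wDiamondHat ρ κ 1 ν).re) (Set.Icc 0 ν₀)

/-- `(x(t), ξ(ν,t))`, `t ∈ ℝ`, solves the equations of motion
`x'' + V₀'(x) = ∫ κ ξ dν`, `ρ (ξ'' + ν² ξ) = κ x`
with the initial data `x(0) = x₀`, `x'(0) = x₁`, `ξ(ν,0) = ξ₀(ν)`, `ξ'(ν,0) = ξ₁(ν)`.
The second equation and the initial data for `ξ` hold for almost every frequency `ν`. -/
structure IsSolution (ρ κ V₀ : ℝ → ℝ) (x₀ x₁ : ℝ) (ξ₀ ξ₁ : ℝ → ℝ)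
    (x : ℝ → ℝ) (ξ : ℝ → ℝ → ℝ) : Prop where
  differentiable : Differentiable ℝ x
  differentiable_deriv : Differentiable ℝ (deriv x)
  integrable_force : ∀ t : ℝ, Integrable (fun ν : ℝ => κ ν * ξ ν t)
  oscillator : ∀ t : ℝ, deriv (deriv x) t + deriv V₀ (x t) = ∫ ν : ℝ, κ ν * ξ ν t
  thermostat : ∀ᵐ ν : ℝ, Differentiable ℝ (ξ ν) ∧ Differentiable ℝ (deriv (ξ ν)) ∧
    ∀ t : ℝ, ρ ν * (deriv (deriv (ξ ν)) t + ν ^ 2 * ξ ν t) = κ ν * x t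
  initial_oscillator : x 0 = x₀ ∧ deriv x 0 = x₁
  initial_thermostat : ∀ᵐ ν : ℝ, ξ ν 0 = ξ₀ ν ∧ deriv (ξ ν) 0 = ξ₁ ν

end Thermostat

end

/-!
Put `b = â / ν`, which is continuous and nonzero away from frequency zero and has `∫ b² = K`, and
attach to each frequency the complex amplitude `z = √ρ (ξ' + iνξ) - i b x`. It satisfies
`z' = iνz - i b x'`, and the equation of the oscillator becomes `x'' + V'(x) = ∫ b Im z dν` with the
effective potential `V` (`isReducedMotion_of_isSolution`).

The energy `x'² / 2 + V(x) + ½ ∫ |z|² dν` is conserved (`IsReducedMotion.energy_eq`). Since `V` is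
bounded below with compact sublevel sets, `x`, `x'`, `∫ |z|²` and hence `x''` are bounded for all
times. By variation of constants `z(ν, t) = e^{iνt} (z₀ - i b ∫₀ᵗ e^{-iνs} x'(s) ds)`, so the energy
bound says that the Fourier transforms of the truncations of `x'` are bounded in `L²(b² dν)`. As `b`
is continuous and nonzero away from frequency zero, Plancherel's theorem and Fatou's lemma show that
`φ ∗ x' ∈ L²` for each Schwartz function `φ` whose frequencies are bounded and bounded away from
zero; being Lipschitz, `φ ∗ x'` tends to zero at infinity (`tendsto_convolution_of_energy_bound`).
The high frequencies of `x'` are uniformly small because `x'` is Lipschitz, the low ones because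
`x'` is the derivative of a bounded function. Hence `x' → 0` (`tendsto_zero_of_energy_bound`).

Next, `V'(x) → 0` (`IsReducedMotion.tendsto_force`). Modes with `|ν| ≤ δ` contribute little to the
force when `δ` is small, and the force of the others is minus the derivative of the bounded function
`∫_{|ν| > δ} (b / ν) Re z dν`. So up to sign and a small error `V'(x)` is the derivative of a
bounded function, and it is small somewhere in every long time window. As `x' → 0`, the position is
nearly constant on such a window, and `V'(x)` is small throughout. Finally, a bounded path along which
`V'(x) → 0` can oscillate only within an interval of critical points, and there is none
(`exists_tendsto_of_tendsto_comp_zero`). Both time directions are handled at once by working along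
`cocompact ℝ`.
-/

namespace Thermostat

open scoped FourierTransform SchwartzMap Convolution

/-! ### Decay of band-limited convolutions -/

/-- Plancherel's theorem for the convolution of `h` with a band-limited Schwartz function. -/
lemma integral_norm_sq_convolution (χ : 𝓢(ℝ, ℂ)) (hχ : HasCompactSupport χ) (h : ℝ → ℂ)
    (hi : Integrable h) (hh : ∀ n : ℕ, Integrable (fun v : ℝ => ‖v‖ ^ n * ‖h v‖)) :
    Continuous (fun t => ∫ s, h s * 𝓕⁻ χ (t - s)) ∧
    Integrable (fun t => ‖∫ s, h s * 𝓕⁻ χ (t - s)‖ ^ 2) ∧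
    ∫ t, ‖∫ s, h s * 𝓕⁻ χ (t - s)‖ ^ 2 = ∫ w, ‖χ w * 𝓕 h w‖ ^ 2 := by
  set g : ℝ → ℂ := h ⋆[ContinuousLinearMap.mul ℂ ℂ] (𝓕⁻ χ : 𝓢(ℝ, ℂ)) with hg
  have hgeq : (fun t => ∫ s, h s * 𝓕⁻ χ (t - s)) = g := by
    ext t; simp [hg, convolution_def]
  have hcont : Continuous g := by
    refine BddAbove.continuous_convolution_right_of_integrable _ ?_ hi (𝓕⁻ χ).continuous
    obtain ⟨C, hC⟩ := (𝓕⁻ χ).decay 0 0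
    refine ⟨C, ?_⟩
    rintro _ ⟨x, rfl⟩
    simpa using hC.2 x
  have hfin : Integrable g := hi.integrable_convolution _ (𝓕⁻ χ).integrable
  have hF : 𝓕 g = fun w => χ w * 𝓕 h w := by
    ext w
    rw [hg, Real.fourier_mul_convolution_eq hi (𝓕⁻ χ).integrable, ← SchwartzMap.fourier_coe,
      FourierTransform.fourier_fourierInv_eq, mul_comm]
  have hsm : ContDiff ℝ ∞ (fun w => χ w * 𝓕 h w) :=
    (χ.smooth ⊤).mul (Real.contDiff_fourier (N := ⊤) (fun n _ => hh n))
  have hcs : HasCompactSupport (fun w => χ w * 𝓕 h w) := hχ.mul_right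
  set S : 𝓢(ℝ, ℂ) := hcs.toSchwartzMap hsm with hS
  have hSF : (S : ℝ → ℂ) = 𝓕 g := by rw [hF]; rfl
  have hgS : (𝓕⁻ S : 𝓢(ℝ, ℂ)) = g := by
    rw [SchwartzMap.fourierInv_coe, hSF]
    exact hcont.fourierInv_fourier_eq hfin (hSF ▸ S.integrable)
  have key := SchwartzMap.integral_norm_sq_fourier (𝓕⁻ S)
  rw [FourierTransform.fourier_fourierInv_eq, hgS] at key
  refine ⟨hgeq ▸ hcont, ?_, ?_⟩
  · have := ((𝓕⁻ S).memLp 2).norm.integrable_sq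
    rw [hgS] at this
    exact (congrArg (fun f : ℝ → ℂ => Integrable fun t => ‖f t‖ ^ 2) hgeq).mpr this
  · rw [show (∫ t, ‖∫ s, h s * 𝓕⁻ χ (t - s)‖ ^ 2) = ∫ t, ‖g t‖ ^ 2 by rw [← hgeq], ← key]
    rfl

lemma eventually_cocompact_iff {p : ℝ → Prop} :
    (∀ᶠ t in cocompact ℝ, p t) ↔ ∃ R, ∀ t, R ≤ |t| → p t := by
  rw [← comap_dist_left_atTop_eq_cocompact (0 : ℝ),
    (atTop_basis.comap (dist (0 : ℝ))).eventually_iff]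
  simp

/-- An integrable Lipschitz function vanishes at infinity. -/
lemma tendsto_zero_of_lipschitz_of_integrable {h : ℝ → ℝ} {L : ℝ}
    (hL : ∀ s t, |h s - h t| ≤ L * |s - t|) (hi : Integrable h) :
    Tendsto h (cocompact ℝ) (𝓝 0) := by
  have hL0 : 0 ≤ L := by
    have := hL 1 0
    simp at this; exact (abs_nonneg _).trans this
  rw [Metric.tendsto_nhds]
  intro ε hε
  set δ := ε / (2 * (L + 1)) with hδ
  have hδ0 : 0 < δ := by positivity
  have hLδ : L * δ ≤ ε / 2 := by
    have : (L + 1) * δ = ε / 2 := by rw [hδ]; field_simp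
    linarith
  have hlim := intervalIntegral_tendsto_integral hi.norm tendsto_neg_atTop_atBot tendsto_id
  have hlim' := (hlim.eventually (lt_mem_nhds (sub_lt_self _ (by positivity : 0 < ε * δ)))).and
    (eventually_ge_atTop 0)
  obtain ⟨N, hN, hN0⟩ := hlim'.exists
  simp only [id] at hN
  rw [intervalIntegral.integral_of_le (by linarith)] at hN
  rw [eventually_cocompact_iff]
  refine ⟨N + 2 * δ, fun t ht => ?_⟩
  rw [dist_zero_right, Real.norm_eq_abs]
  by_contra! hcon
  -- On the interval of radius `δ` around `t` the function stays above `ε / 2`.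
  have hlow : ε / 2 * (2 * δ) ≤ ∫ s in Set.Ioc (t - δ) (t + δ), ‖h s‖ := by
    have h1 : ∫ s in Set.Ioc (t - δ) (t + δ), ε / 2 = ε / 2 * (2 * δ) := by
      rw [setIntegral_const, measureReal_def, Real.volume_Ioc, ENNReal.toReal_ofReal (by linarith)]
      simp; ring
    rw [← h1]
    refine setIntegral_mono_on (by simp) hi.norm.integrableOn
      measurableSet_Ioc fun s hs => ?_
    have h2 := hL t s
    have h3 : |t - s| ≤ δ := by rw [abs_le]; constructor <;> linarith [hs.1, hs.2]
    have h4 := abs_sub_abs_le_abs_sub (h t) (h s)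
    have h5 := mul_le_mul_of_nonneg_left h3 hL0
    rw [Real.norm_eq_abs]; linarith
  have hdisj : Disjoint (Set.Ioc (-N) N) (Set.Ioc (t - δ) (t + δ)) := by
    rw [Set.disjoint_left]
    intro s hs hs'
    rcases le_abs'.1 ht with h | h
    · linarith [hs.1, hs'.2]
    · linarith [hs.2, hs'.1]
  have hun := setIntegral_union hdisj measurableSet_Ioc hi.norm.integrableOn hi.norm.integrableOn
  have hle := setIntegral_le_integral (s := Set.Ioc (-N) N ∪ Set.Ioc (t - δ) (t + δ)) hi.norm
    (ae_of_all _ fun s => norm_nonneg _)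
  linarith

/-- If the truncations of a bounded Lipschitz function `f` have Fourier transforms that are bounded
in a weighted `L²` space, the weight being positive away from frequency zero, then the convolutions
of `f` with Schwartz functions whose frequencies are bounded and bounded away from zero tend to
zero at infinity. -/
lemma tendsto_convolution_of_energy_bound {f b : ℝ → ℝ} {M L C : ℝ}
    (hM : ∀ t, |f t| ≤ M) (hL : ∀ s t, |f s - f t| ≤ L * |s - t|)
    (hb : ContinuousOn b {0}ᶜ) (hb0 : ∀ ν ≠ 0, b ν ≠ 0)
    (hfin : ∀ T : ℝ, 0 ≤ T → Integrable (fun ν : ℝ =>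
      b ν ^ 2 * ‖∫ s in (-T)..T, Complex.exp (-(Complex.I * ν * s)) * f s‖ ^ 2))
    (hC : ∀ T : ℝ, 0 ≤ T → ∫ ν : ℝ,
      b ν ^ 2 * ‖∫ s in (-T)..T, Complex.exp (-(Complex.I * ν * s)) * f s‖ ^ 2 ≤ C)
    (χ : 𝓢(ℝ, ℂ)) (hχ : HasCompactSupport χ) (hχ0 : (0 : ℝ) ∉ tsupport χ) :
    Tendsto (fun t => ‖∫ s, (f s : ℂ) * 𝓕⁻ χ (t - s)‖) (cocompact ℝ) (𝓝 0) := by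
  have hM0 : 0 ≤ M := (abs_nonneg _).trans (hM 0)
  have hfc : Continuous f := by
    have hL0 : 0 ≤ L := by
      have := hL 1 0
      simp at this; exact (abs_nonneg _).trans this
    refine (LipschitzWith.of_dist_le_mul (K := ⟨L, hL0⟩) fun s t => ?_).continuous
    exact hL s t
  set φ : 𝓢(ℝ, ℂ) := 𝓕⁻ χ with hφ
  set g : ℝ → ℂ := fun t => ∫ s, (f s : ℂ) * φ (t - s) with hg
  have hφi : ∀ t, Integrable fun s => φ (t - s) := fun t => φ.integrable.comp_sub_left t
  -- The truncations of `f` and the corresponding convolutions.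
  set h : ℕ → ℝ → ℂ := fun n => (Set.Ioc (-(n : ℝ)) n).indicator fun s => (f s : ℂ) with hh
  have hhm : ∀ (n k : ℕ), Integrable fun v : ℝ => ‖v‖ ^ k * ‖h n v‖ := by
    intro n k
    have : (fun v : ℝ => ‖v‖ ^ k * ‖h n v‖)
        = (Set.Ioc (-(n : ℝ)) n).indicator fun v => ‖v‖ ^ k * ‖(f v : ℂ)‖ := by
      ext v; by_cases hv : v ∈ Set.Ioc (-(n : ℝ)) n <;> simp [hh, hv]
    rw [this, integrable_indicator_iff measurableSet_Ioc]
    exact (Continuous.integrableOn_Icc (by fun_prop)).mono_set Set.Ioc_subset_Icc_self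
  have hhi : ∀ n, Integrable (h n) := by
    intro n
    rw [hh, integrable_indicator_iff measurableSet_Ioc]
    exact (Continuous.integrableOn_Icc (by fun_prop)).mono_set Set.Ioc_subset_Icc_self
  have hP := fun n => integral_norm_sq_convolution χ hχ (h n) (hhi n) (hhm n)
  -- The weight dominates the band-limited multiplier.
  obtain ⟨D, hD0, hD⟩ : ∃ D : ℝ, 0 ≤ D ∧ ∀ w, ‖χ w‖ ^ 2 ≤ D * b (2 * Real.pi * w) ^ 2 := by
    have hcont : ContinuousOn (fun w => ‖χ w‖ ^ 2 / b (2 * Real.pi * w) ^ 2) (tsupport χ) := by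
      have hne : ∀ w ∈ tsupport χ, 2 * Real.pi * w ≠ 0 := fun w hw h0 => by
        have : w = 0 := by simpa [Real.pi_ne_zero] using h0
        exact hχ0 (this ▸ hw)
      refine ContinuousOn.div (by fun_prop) ((hb.comp (by fun_prop) fun w hw => ?_).pow 2)
        fun w hw => pow_ne_zero 2 (hb0 _ (hne w hw))
      exact hne w hw
    obtain ⟨D, hD⟩ := IsCompact.exists_bound_of_continuousOn hχ hcont
    refine ⟨max D 0, le_max_right _ _, fun w => ?_⟩
    by_cases hw : w ∈ tsupport χ
    · have hbw : b (2 * Real.pi * w) ≠ 0 := hb0 _ fun h0 => by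
        have : w = 0 := by simpa [Real.pi_ne_zero] using h0
        exact hχ0 (this ▸ hw)
      have h1 := (le_abs_self _).trans ((hD w hw).trans (le_max_left D 0))
      rwa [div_le_iff₀ (by positivity)] at h1
    · rw [image_eq_zero_of_notMem_tsupport hw]
      simp only [norm_zero, ne_eq, OfNat.ofNat_ne_zero, not_false_eq_true, zero_pow]
      positivity
  have hbound : ∀ n : ℕ, ∫ t, ‖∫ s, h n s * φ (t - s)‖ ^ 2 ≤ D * C := by
    intro n
    set E : ℝ → ℝ := fun ν =>
      b ν ^ 2 * ‖∫ s in (-(n : ℝ))..n, Complex.exp (-(Complex.I * ν * s)) * f s‖ ^ 2 with hE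
    have hFE : ∀ w, 𝓕 (h n) w
        = ∫ s in (-(n : ℝ))..n, Complex.exp (-(Complex.I * (2 * Real.pi * w : ℝ) * s)) * f s := by
      intro w
      rw [intervalIntegral.integral_of_le (by linarith [n.cast_nonneg (α := ℝ)]),
        ← integral_indicator measurableSet_Ioc, Real.fourier_eq']
      congr 1; ext s
      by_cases hs : s ∈ Set.Ioc (-(n : ℝ)) n
      · simp only [hh, hs, Set.indicator_of_mem, smul_eq_mul]
        congr 2; simp; ring
      · simp [hh, hs]
    have hEint : Integrable (fun w => E (2 * Real.pi * w)) :=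
      (hfin n n.cast_nonneg).comp_mul_left' (by positivity)
    have h2 : ∫ w, E (2 * Real.pi * w) ≤ C := by
      have h3 : ∫ ν, E ν ≤ C := hC n n.cast_nonneg
      have h4 : 0 ≤ ∫ ν, E ν := integral_nonneg fun ν => by positivity
      rw [Measure.integral_comp_mul_left, smul_eq_mul]
      refine le_trans (mul_le_of_le_one_left h4 ?_) h3
      rw [abs_inv, abs_of_pos (by positivity)]
      exact inv_le_one_of_one_le₀ (by linarith [Real.pi_gt_three])
    rw [(hP n).2.2]
    calc ∫ w, ‖χ w * 𝓕 (h n) w‖ ^ 2 ≤ ∫ w, D * E (2 * Real.pi * w) := by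
          refine integral_mono_of_nonneg (ae_of_all _ fun w => by positivity)
            (hEint.const_mul D) (ae_of_all _ fun w => ?_)
          simp only [norm_mul, mul_pow, hFE, hE, ← mul_assoc]
          exact mul_le_mul_of_nonneg_right (hD w) (by positivity)
      _ ≤ D * C := by
          rw [integral_const_mul]
          exact mul_le_mul_of_nonneg_left h2 hD0
  -- Fatou's lemma.
  have hgsq : Integrable fun t => ‖g t‖ ^ 2 := by
    refine integrable_of_tendsto (G := fun (n : ℕ) t => ‖∫ s, h n s * φ (t - s)‖ ^ 2)
      (ae_of_all _ fun t => ?_) (fun n => (hP n).2.1.aestronglyMeasurable) ?_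
    · refine ((tendsto_integral_of_dominated_convergence (fun s => M * ‖φ (t - s)‖)
        (fun n => ?_) ((hφi t).norm.const_mul M) (fun n => ae_of_all _ fun s => ?_)
        (ae_of_all _ fun s => ?_)).norm).pow 2
      · exact (hhi n).aestronglyMeasurable.mul (hφi t).aestronglyMeasurable
      · rw [norm_mul]
        refine mul_le_mul_of_nonneg_right ?_ (norm_nonneg _)
        refine (norm_indicator_le_norm_self _ _).trans ?_
        simpa using hM s
      · refine tendsto_const_nhds.congr' ?_
        filter_upwards [eventually_gt_atTop ⌈|s|⌉₊] with n hn
        have h1 : |s| < n := (Nat.le_ceil _).trans_lt (by exact_mod_cast hn)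
        have h2 : s ∈ Set.Ioc (-(n : ℝ)) n := ⟨(abs_lt.1 h1).1, (abs_lt.1 h1).2.le⟩
        simp [hh, h2]
    · refine ne_top_of_le_ne_top (b := ENNReal.ofReal (D * C)) ENNReal.ofReal_ne_top ?_
      refine liminf_le_of_le (by isBoundedDefault) fun a ha => ?_
      obtain ⟨n, hn⟩ := ha.exists
      refine hn.trans ?_
      have hE := ofReal_integral_norm_eq_lintegral_enorm (hP n).2.1
      rw [← hE]
      refine ENNReal.ofReal_le_ofReal (le_trans (le_of_eq ?_) (hbound n))
      simp [hφ]
  set Φ : ℝ := ∫ u, ‖φ u‖ with hΦ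
  have hΦ0 : 0 ≤ Φ := integral_nonneg fun _ => norm_nonneg _
  have hgM : ∀ t, ‖g t‖ ≤ M * Φ := by
    intro t
    refine (norm_integral_le_of_norm_le ((hφi t).norm.const_mul M)
      (ae_of_all _ fun s => ?_)).trans (le_of_eq ?_)
    · rw [norm_mul]
      exact mul_le_mul_of_nonneg_right (by simpa using hM s) (norm_nonneg _)
    · rw [integral_const_mul, integral_sub_left_eq_self (fun u => ‖φ u‖) volume t]
  have hgswap : ∀ t, g t = ∫ u, (f (t - u) : ℂ) * φ u := by
    intro t
    rw [hg, ← integral_sub_left_eq_self _ volume t]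
    simp
  have hgL : ∀ s t, ‖g s - g t‖ ≤ L * |s - t| * Φ := by
    intro s t
    have hi : ∀ t, Integrable fun u => (f (t - u) : ℂ) * φ u := fun t =>
      φ.integrable.bdd_mul (c := M) (by fun_prop) (ae_of_all _ fun s => by simpa using hM _)
    rw [hgswap, hgswap, ← integral_sub (hi s) (hi t), hΦ, ← integral_const_mul]
    refine norm_integral_le_of_norm_le (φ.integrable.norm.const_mul _) (ae_of_all _ fun u => ?_)
    rw [← sub_mul, norm_mul, ← Complex.ofReal_sub, Complex.norm_real]
    refine mul_le_mul_of_nonneg_right ?_ (norm_nonneg _)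
    simpa using hL (s - u) (t - u)
  have hsq : Tendsto (fun t => ‖g t‖ ^ 2) (cocompact ℝ) (𝓝 0) := by
    refine tendsto_zero_of_lipschitz_of_integrable (L := 2 * (M * Φ) * (L * Φ)) (fun s t => ?_) hgsq
    have h1 : ‖g s‖ ^ 2 - ‖g t‖ ^ 2 = (‖g s‖ + ‖g t‖) * (‖g s‖ - ‖g t‖) := by ring
    rw [h1, abs_mul, abs_of_nonneg (by positivity)]
    calc (‖g s‖ + ‖g t‖) * |‖g s‖ - ‖g t‖| ≤ (2 * (M * Φ)) * (L * |s - t| * Φ) :=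
          mul_le_mul (by linarith [hgM s, hgM t]) ((abs_norm_sub_norm_le _ _).trans (hgL s t))
            (abs_nonneg _) (by positivity)
      _ = _ := by ring
  have := hsq.sqrt
  simpa [Real.sqrt_sq (norm_nonneg _), SchwartzMap.fourierInv_coe] using this

/-! ### Decay of the velocity from a weighted bound on its Fourier transform -/

/-- The inverse Fourier transform of a dilated function. -/
lemma fourierInv_comp_mul_left (β : ℝ → ℂ) {r : ℝ} (hr : 0 < r) (u : ℝ) :
    𝓕⁻ (fun w => β (r * w)) u = (r⁻¹ : ℝ) * 𝓕⁻ β (r⁻¹ * u) := by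
  have h := Measure.integral_comp_mul_left
    (fun v => Complex.exp (↑(2 * Real.pi * inner ℝ v (r⁻¹ * u)) * Complex.I) • β v) r
  rw [abs_of_pos (inv_pos.2 hr), Complex.real_smul] at h
  rw [Real.fourierInv_eq', Real.fourierInv_eq', ← h]
  congr 1; ext w
  congr 4
  simp; field_simp

/-- Changing variables in a convolution with a dilated kernel. -/
lemma integral_mul_dilation (F η : ℝ → ℂ) {r : ℝ} (hr : 0 < r) (t : ℝ) :
    ∫ s, F s * ((r⁻¹ : ℝ) * η (r⁻¹ * (t - s))) = ∫ v, η v * F (t - r * v) := by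
  rw [← integral_sub_left_eq_self _ volume t]
  have h := Measure.integral_comp_mul_left (fun v => η v * F (t - r * v)) r⁻¹
  rw [inv_inv, abs_of_pos hr] at h
  rw [← inv_smul_smul₀ hr.ne' (∫ v, η v * F (t - r * v)), ← h, ← integral_smul]
  congr 1; ext u
  rw [mul_inv_cancel_left₀ hr.ne', sub_sub_cancel, Complex.real_smul]
  ring

/-- A bounded Lipschitz function with bounded primitive tends to zero at infinity, if the Fourier
transforms of its truncations are bounded in a weighted `L²` space whose weight is positive away
from frequency zero. -/
lemma tendsto_zero_of_energy_bound {x f b : ℝ → ℝ} {B M L C : ℝ}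
    (hx : ∀ t, HasDerivAt x (f t) t) (hB : ∀ t, |x t| ≤ B)
    (hM : ∀ t, |f t| ≤ M) (hL : ∀ s t, |f s - f t| ≤ L * |s - t|)
    (hb : ContinuousOn b {0}ᶜ) (hb0 : ∀ ν ≠ 0, b ν ≠ 0)
    (hfin : ∀ T : ℝ, 0 ≤ T → Integrable (fun ν : ℝ =>
      b ν ^ 2 * ‖∫ s in (-T)..T, Complex.exp (-(Complex.I * ν * s)) * f s‖ ^ 2))
    (hC : ∀ T : ℝ, 0 ≤ T → ∫ ν : ℝ,
      b ν ^ 2 * ‖∫ s in (-T)..T, Complex.exp (-(Complex.I * ν * s)) * f s‖ ^ 2 ≤ C) :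
    Tendsto f (cocompact ℝ) (𝓝 0) := by
  have hB0 : 0 ≤ B := (abs_nonneg _).trans (hB 0)
  have hL0 : 0 ≤ L := by
    have := hL 1 0
    simp at this; exact (abs_nonneg _).trans this
  have hfc : Continuous f := by
    refine (LipschitzWith.of_dist_le_mul (K := ⟨L, hL0⟩) fun s t => ?_).continuous
    exact hL s t
  have hxc : Continuous x := continuous_iff_continuousAt.2 fun t => (hx t).continuousAt
  -- A Schwartz function `η` whose Fourier transform is a bump function, equal to one near zero.
  let bump : ContDiffBump (0 : ℝ) := ⟨1, 2, one_pos, one_lt_two⟩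
  have hβs : ContDiff ℝ ∞ (fun w => (bump w : ℂ)) :=
    Complex.ofRealCLM.contDiff.comp bump.contDiff
  have hβc : HasCompactSupport (fun w => (bump w : ℂ)) :=
    bump.hasCompactSupport.comp_left (g := Complex.ofReal) Complex.ofReal_zero
  set β : 𝓢(ℝ, ℂ) := hβc.toSchwartzMap hβs with hβ
  have hβv : ∀ w, β w = (bump w : ℂ) := fun w => rfl
  set η : 𝓢(ℝ, ℂ) := 𝓕⁻ β with hη
  have hη1 : ∫ v, η v = 1 := by
    have h1 : 𝓕 η 0 = β 0 := by rw [hη, FourierTransform.fourier_fourierInv_eq]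
    rw [SchwartzMap.fourier_coe, Real.fourier_eq', hβv, bump.one_of_mem_closedBall (by simp [bump])]
      at h1
    simpa using h1
  set A₁ : ℝ := ∫ v, ‖v‖ ^ 1 * ‖η v‖ with hA₁
  set A₂ : ℝ := ∫ v, ‖SchwartzMap.derivCLM ℝ ℂ η v‖ with hA₂
  have hA₁0 : 0 ≤ A₁ := integral_nonneg fun _ => by positivity
  have hA₂0 : 0 ≤ A₂ := integral_nonneg fun _ => by positivity
  have hηf : ∀ r t : ℝ, Integrable fun v => η v * (f (t - r * v) : ℂ) := fun r t =>
    η.integrable.mul_bdd (c := M) (by fun_prop) (ae_of_all _ fun s => by simpa using hM _)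
  -- At high frequencies the Lipschitz bound is used.
  have hhigh : ∀ r > 0, ∀ t, ‖(f t : ℂ) - ∫ v, η v * (f (t - r * v) : ℂ)‖ ≤ L * r * A₁ := by
    intro r hr t
    have h1 : (f t : ℂ) = ∫ v, η v * (f t : ℂ) := by rw [integral_mul_const, hη1, one_mul]
    rw [h1, ← integral_sub (η.integrable.mul_const _) (hηf r t), hA₁, ← integral_const_mul]
    refine norm_integral_le_of_norm_le ((η.integrable_pow_mul volume 1).const_mul _)
      (ae_of_all _ fun v => ?_)
    rw [← mul_sub, norm_mul, ← Complex.ofReal_sub, Complex.norm_real, pow_one]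
    have h2 := hL t (t - r * v)
    rw [sub_sub_cancel, abs_mul, abs_of_pos hr] at h2
    calc ‖η v‖ * ‖f t - f (t - r * v)‖ ≤ ‖η v‖ * (L * (r * |v|)) :=
          mul_le_mul_of_nonneg_left h2 (norm_nonneg _)
      _ = _ := by rw [Real.norm_eq_abs]; ring
  -- At low frequencies one integrates by parts and uses the bound on `x`.
  have hlow : ∀ r > 0, ∀ t, ‖∫ v, η v * (f (t - r * v) : ℂ)‖ ≤ B * r⁻¹ * A₂ := by
    intro r hr t
    have hd : ∀ v, HasDerivAt (fun v => (((-r⁻¹) * x (t - r * v) : ℝ) : ℂ))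
        (f (t - r * v) : ℂ) v := by
      intro v
      refine HasDerivAt.ofReal_comp ?_
      have h1 : HasDerivAt (fun v => t - r * v) (-r) v := by
        simpa using ((hasDerivAt_id v).const_mul r).const_sub t
      refine (((hx (t - r * v)).comp v h1).const_mul (-r⁻¹)).congr_deriv ?_
      rw [mul_neg, neg_mul_neg, mul_left_comm, inv_mul_cancel₀ hr.ne', mul_one]
    have hbd : ∀ v, ‖(((-r⁻¹) * x (t - r * v) : ℝ) : ℂ)‖ ≤ B * r⁻¹ := by
      intro v
      rw [Complex.norm_real, norm_mul, norm_neg, norm_inv, Real.norm_of_nonneg hr.le, mul_comm B]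
      exact mul_le_mul_of_nonneg_left (hB _) (by positivity)
    have hcd : Continuous fun v => (((-r⁻¹) * x (t - r * v) : ℝ) : ℂ) := by fun_prop
    have hibp := integral_mul_deriv_eq_deriv_mul_of_integrable
      (u := η) (u' := SchwartzMap.derivCLM ℝ ℂ η) (v := fun v => (((-r⁻¹) * x (t - r * v) : ℝ) : ℂ))
      (v' := fun v => (f (t - r * v) : ℂ))
      (fun v _ => η.differentiableAt.hasDerivAt) (fun v _ => hd v) (hηf r t)
      ((SchwartzMap.derivCLM ℝ ℂ η).integrable.mul_bdd (c := B * r⁻¹)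
        hcd.aestronglyMeasurable (ae_of_all _ hbd))
      (η.integrable.mul_bdd (c := B * r⁻¹) hcd.aestronglyMeasurable (ae_of_all _ hbd))
    rw [hibp, norm_neg, hA₂, ← integral_const_mul]
    refine norm_integral_le_of_norm_le ((SchwartzMap.derivCLM ℝ ℂ η).integrable.norm.const_mul _)
      (ae_of_all _ fun v => ?_)
    rw [norm_mul, mul_comm]
    exact mul_le_mul_of_nonneg_right (hbd v) (norm_nonneg _)
  -- The intermediate frequencies do not contribute in the limit.
  have hmid : ∀ r > 0, ∀ R > r, Tendsto (fun t => ‖(∫ v, η v * (f (t - r * v) : ℂ))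
      - ∫ v, η v * (f (t - R * v) : ℂ)‖) (cocompact ℝ) (𝓝 0) := by
    intro r hr0 R hR
    have hR0 : 0 < R := hr0.trans hR
    have hsupp : ∀ w, (β (r * w) - β (R * w)) ≠ 0 → R⁻¹ ≤ |w| ∧ |w| ≤ 2 * r⁻¹ := by
      intro w hw
      refine ⟨?_, ?_⟩
      · by_contra! hcon
        have h1 : |R * w| ≤ 1 := by
          rw [abs_mul, abs_of_pos hR0]
          calc R * |w| ≤ R * R⁻¹ := by gcongr
            _ = 1 := by field_simp
        have h2 : |r * w| ≤ 1 := by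
          refine le_trans ?_ h1
          rw [abs_mul, abs_mul, abs_of_pos hR0, abs_of_pos hr0]
          gcongr
        refine hw ?_
        rw [hβv, hβv, bump.one_of_mem_closedBall (by simpa [bump] using h2),
          bump.one_of_mem_closedBall (by simpa [bump] using h1), sub_self]
      · by_contra! hcon
        have h1 : 2 ≤ |r * w| := by
          rw [abs_mul, abs_of_pos hr0]
          calc 2 = r * (2 * r⁻¹) := by field_simp
            _ ≤ r * |w| := by gcongr
        have h2 : 2 ≤ |R * w| := by
          refine h1.trans ?_
          rw [abs_mul, abs_mul, abs_of_pos hR0, abs_of_pos hr0]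
          gcongr
        refine hw ?_
        rw [hβv, hβv, bump.zero_of_le_dist (by simpa [bump] using h1),
          bump.zero_of_le_dist (by simpa [bump] using h2), sub_self]
    have hsub : tsupport (fun w => β (r * w) - β (R * w))
        ⊆ {w | R⁻¹ ≤ |w|} ∩ {w | |w| ≤ 2 * r⁻¹} := by
      refine closure_minimal (fun w hw => hsupp w hw) (IsClosed.inter ?_ ?_)
      · exact isClosed_le continuous_const continuous_abs
      · exact isClosed_le continuous_abs continuous_const
    have hcs : HasCompactSupport (fun w => β (r * w) - β (R * w)) := by
      refine HasCompactSupport.of_support_subset_isCompact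
        (isCompact_closedBall (0 : ℝ) (2 * r⁻¹)) fun w hw => ?_
      simpa using (hsupp w hw).2
    have hsm : ContDiff ℝ ∞ (fun w => β (r * w) - β (R * w)) :=
      ((β.smooth ⊤).comp (contDiff_const.mul contDiff_id)).sub
        ((β.smooth ⊤).comp (contDiff_const.mul contDiff_id))
    set χ : 𝓢(ℝ, ℂ) := hcs.toSchwartzMap hsm with hχ
    have hχcs : HasCompactSupport χ := hcs
    have hχ0 : (0 : ℝ) ∉ tsupport χ := by
      intro h0
      have := (hsub h0).1
      simp only [Set.mem_ofPred_eq, abs_zero] at this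
      exact absurd (inv_pos.2 hR0) (not_lt.2 this)
    have hlim := tendsto_convolution_of_energy_bound hM hL hb hb0 hfin hC χ hχcs hχ0
    refine hlim.congr fun t => ?_
    have hker : ∀ u, 𝓕⁻ χ u = (r⁻¹ : ℝ) * η (r⁻¹ * u) - (R⁻¹ : ℝ) * η (R⁻¹ * u) := by
      intro u
      have h1 : (χ : ℝ → ℂ) = (fun w => β (r * w)) - fun w => β (R * w) := rfl
      have hi : ∀ q : ℝ, 0 < q → Integrable fun v : ℝ =>
          Complex.exp (↑(2 * Real.pi * inner ℝ v u) * Complex.I) • β (q * v) := fun q hq =>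
        (β.integrable.comp_mul_left' hq.ne').bdd_mul (c := 1) (by fun_prop)
          (ae_of_all _ fun v => (Complex.norm_exp_ofReal_mul_I _).le)
      rw [hη, SchwartzMap.fourierInv_coe, SchwartzMap.fourierInv_coe,
        ← fourierInv_comp_mul_left β hr0 u, ← fourierInv_comp_mul_left β hR0 u, h1,
        Real.fourierInv_eq', Real.fourierInv_eq', Real.fourierInv_eq',
        ← integral_sub (hi r hr0) (hi R hR0)]
      simp only [Pi.sub_apply, smul_sub]
    have hi : ∀ q : ℝ, 0 < q → Integrable fun s : ℝ =>
        (f s : ℂ) * ((q⁻¹ : ℝ) * η (q⁻¹ * (t - s))) := fun q hq =>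
      (((η.integrable.comp_mul_left' (inv_pos.2 hq).ne').comp_sub_left t).const_mul _).bdd_mul
        (c := M) (by fun_prop) (ae_of_all _ fun s => by simpa using hM s)
    rw [← integral_mul_dilation (fun s => (f s : ℂ)) η hr0 t,
      ← integral_mul_dilation (fun s => (f s : ℂ)) η hR0 t, ← integral_sub (hi r hr0) (hi R hR0)]
    simp only [hker, mul_sub]
  rw [Metric.tendsto_nhds]
  intro ε hε
  -- The scales make the high and the low frequency part at most `ε / 4` each.
  set r : ℝ := ε / (4 * (L * A₁ + 1)) with hr
  have hr0 : 0 < r := by positivity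
  set R : ℝ := r + 4 * (B * A₂ + 1) / ε with hR
  have hRr : r < R := by rw [hR]; linarith [show 0 < 4 * (B * A₂ + 1) / ε by positivity]
  have hR0 : 0 < R := hr0.trans hRr
  filter_upwards [(hmid r hr0 R hRr).eventually (gt_mem_nhds (by positivity : (0 : ℝ) < ε / 4))]
    with t ht
  have h1 := hhigh r hr0 t
  have h2 := hlow R hR0 t
  have h3 : L * r * A₁ ≤ ε / 4 := by
    have : 4 * (L * A₁ + 1) * r = ε := by rw [hr]; field_simp
    nlinarith
  have h4 : B * R⁻¹ * A₂ ≤ ε / 4 := by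
    have h5 : 4 * (B * A₂ + 1) / ε ≤ R := by rw [hR]; linarith
    rw [div_le_iff₀ hε] at h5
    rw [mul_right_comm, ← div_eq_mul_inv, div_le_iff₀ hR0]
    linarith
  rw [dist_zero_right, ← Complex.norm_real]
  have h6 : (f t : ℂ) = ((f t : ℂ) - ∫ v, η v * (f (t - r * v) : ℂ))
      + ((∫ v, η v * (f (t - r * v) : ℂ)) - ∫ v, η v * (f (t - R * v) : ℂ))
      + ∫ v, η v * (f (t - R * v) : ℂ) := by ring
  rw [h6]
  refine (norm_add₃_le).trans_lt ?_
  linarith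

/-! ### The modes driven by the velocity -/

section Modes

/-- The truncated Fourier transform `∫₀ᵗ e^{-iνs} y(s) ds` of the velocity `y`. -/
noncomputable def truncFourier (y : ℝ → ℝ) (ν t : ℝ) : ℂ :=
  ∫ s in (0 : ℝ)..t, Complex.exp (-(Complex.I * ν * s)) * y s

/-- The amplitude at time `t` of the mode of frequency `ν` that starts from `z₀` and is driven by
the velocity `y` with the coupling `b`, as given by the variation of constants formula for the
equation `z' = iνz - i b y`. -/
noncomputable def amplitude (b : ℝ → ℝ) (z₀ : ℝ → ℂ) (y : ℝ → ℝ) (ν t : ℝ) : ℂ :=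
  Complex.exp (Complex.I * ν * t) * (z₀ ν - Complex.I * b ν * truncFourier y ν t)

variable {b : ℝ → ℝ} {z₀ : ℝ → ℂ} {y : ℝ → ℝ}

lemma hasDerivAt_truncFourier (hy : Continuous y) (ν t : ℝ) :
    HasDerivAt (truncFourier y ν) (Complex.exp (-(Complex.I * ν * t)) * y t) t := by
  have hc : Continuous fun s : ℝ => Complex.exp (-(Complex.I * ν * s)) * (y s : ℂ) := by fun_prop
  exact intervalIntegral.integral_hasDerivAt_right (hc.intervalIntegrable _ _)
    (hc.stronglyMeasurableAtFilter _ _) hc.continuousAt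

lemma continuous_truncFourier (hy : Continuous y) (t : ℝ) :
    Continuous fun ν => truncFourier y ν t :=
  intervalIntegral.continuous_parametric_intervalIntegral_of_continuous'
    (f := fun (ν s : ℝ) => Complex.exp (-(Complex.I * ν * s)) * (y s : ℂ)) (by fun_prop) 0 t

lemma norm_exp_I_mul (ν t : ℝ) : ‖Complex.exp (Complex.I * ν * t)‖ = 1 := by
  rw [show Complex.I * ν * t = ((ν * t : ℝ) : ℂ) * Complex.I by push_cast; ring]
  exact Complex.norm_exp_ofReal_mul_I _

lemma norm_exp_neg_I_mul (ν t : ℝ) : ‖Complex.exp (-(Complex.I * ν * t))‖ = 1 := by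
  rw [show -(Complex.I * ν * t) = ((-(ν * t) : ℝ) : ℂ) * Complex.I by push_cast; ring]
  exact Complex.norm_exp_ofReal_mul_I _

/-- On bounded time intervals the truncated transform is bounded uniformly in the frequency. -/
lemma exists_bound_truncFourier (hy : Continuous y) (T : ℝ) :
    ∃ M, 0 ≤ M ∧ (∀ t, |t| ≤ T → |y t| ≤ M) ∧ ∀ ν t, |t| ≤ T → ‖truncFourier y ν t‖ ≤ M := by
  obtain ⟨M, hM⟩ := (isCompact_Icc (a := -T) (b := T)).exists_bound_of_continuousOn hy.continuousOn
  have hM' : ∀ t, |t| ≤ T → |y t| ≤ max M 0 := fun t ht =>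
    (hM t (abs_le.1 ht)).trans (le_max_left _ _)
  refine ⟨max M 0 * (1 + |T|), by positivity, fun t ht => ?_, fun ν t ht => ?_⟩
  · exact (hM' t ht).trans (le_mul_of_one_le_right (by positivity) (by linarith [abs_nonneg T]))
  · have h := intervalIntegral.norm_integral_le_of_norm_le_const (a := 0) (b := t) (C := max M 0)
      (f := fun s : ℝ => Complex.exp (-(Complex.I * ν * s)) * (y s : ℂ)) fun s hs => by
        rw [norm_mul, norm_exp_neg_I_mul, one_mul, Complex.norm_real]
        refine hM' s (le_trans ?_ ht)
        rcases Set.mem_uIoc.1 hs with h | h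
        · rw [abs_of_pos h.1]; exact h.2.trans (le_abs_self t)
        · rw [abs_of_nonpos h.2, abs_of_nonpos (h.1.le.trans h.2)]; linarith [h.1]
    refine h.trans (mul_le_mul_of_nonneg_left ?_ (by positivity))
    rw [sub_zero]
    linarith [le_abs_self T]

lemma norm_amplitude (ν t : ℝ) :
    ‖amplitude b z₀ y ν t‖ = ‖z₀ ν - Complex.I * b ν * truncFourier y ν t‖ := by
  rw [amplitude, norm_mul, norm_exp_I_mul, one_mul]

lemma norm_amplitude_le {M ν t : ℝ} (h : ‖truncFourier y ν t‖ ≤ M) :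
    ‖amplitude b z₀ y ν t‖ ≤ ‖z₀ ν‖ + |b ν| * M := by
  rw [norm_amplitude]
  refine (norm_sub_le _ _).trans (add_le_add le_rfl ?_)
  rw [norm_mul, norm_mul, Complex.norm_I, one_mul, Complex.norm_real, Real.norm_eq_abs]
  gcongr

/-- Each mode is a harmonic oscillator forced by the velocity. -/
lemma hasDerivAt_amplitude (hy : Continuous y) (ν t : ℝ) :
    HasDerivAt (amplitude b z₀ y ν)
      (Complex.I * ν * amplitude b z₀ y ν t - Complex.I * b ν * y t) t := by
  have h1 : HasDerivAt (fun t : ℝ => Complex.exp (Complex.I * ν * t))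
      (Complex.exp (Complex.I * ν * t) * (Complex.I * ν)) t := by
    have := (((hasDerivAt_id (t : ℂ)).const_mul (Complex.I * ν)).cexp).comp_ofReal
    simpa using this
  have h2 := ((hasDerivAt_truncFourier hy ν t).const_mul (Complex.I * b ν)).const_sub (z₀ ν)
  refine (h1.mul h2).congr_deriv ?_
  have h3 : Complex.exp (Complex.I * ν * t) * Complex.exp (-(Complex.I * ν * t)) = 1 := by
    rw [← Complex.exp_add, add_neg_cancel, Complex.exp_zero]
  rw [amplitude]
  linear_combination (-(Complex.I * b ν * y t)) * h3

lemma aestronglyMeasurable_amplitude (hb : AEStronglyMeasurable b) (hz : AEStronglyMeasurable z₀)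
    (hy : Continuous y) (t : ℝ) : AEStronglyMeasurable fun ν => amplitude b z₀ y ν t := by
  have h1 : Continuous fun ν : ℝ => Complex.exp (Complex.I * ν * t) := by fun_prop
  refine h1.aestronglyMeasurable.mul (hz.sub ?_)
  exact ((Complex.continuous_ofReal.comp_aestronglyMeasurable hb).const_mul _).mul
    (continuous_truncFourier hy t).aestronglyMeasurable

lemma memLp_amplitude (hb : MemLp b 2) (hz : MemLp z₀ 2) (hy : Continuous y) (t : ℝ) :
    MemLp (fun ν => amplitude b z₀ y ν t) 2 := by
  obtain ⟨M, hM0, -, hM⟩ := exists_bound_truncFourier hy |t|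
  refine MemLp.mono' (hz.norm.add (hb.norm.mul_const M))
    (aestronglyMeasurable_amplitude hb.1 hz.1 hy t) (ae_of_all _ fun ν => ?_)
  exact norm_amplitude_le (hM ν t le_rfl)

lemma integrable_mul_amplitude_im {c : ℝ → ℝ} (hc : MemLp c 2) (hb : MemLp b 2) (hz : MemLp z₀ 2)
    (hy : Continuous y) (t : ℝ) : Integrable fun ν => c ν * (amplitude b z₀ y ν t).im :=
  hc.integrable_mul (memLp_amplitude hb hz hy t).im

/-- The energy of the modes changes by the work of the force `∫ b Im z dν`. -/
lemma hasDerivAt_integral_norm_sq (hb : MemLp b 2) (hz : MemLp z₀ 2) (hy : Continuous y) (t : ℝ) :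
    HasDerivAt (fun t => ∫ ν, ‖amplitude b z₀ y ν t‖ ^ 2)
      (-2 * y t * ∫ ν, b ν * (amplitude b z₀ y ν t).im) t := by
  obtain ⟨M, hM0, hyM, hM⟩ := exists_bound_truncFourier hy (|t| + 1)
  have hball : ∀ s ∈ Metric.ball t 1, |s| ≤ |t| + 1 := by
    intro s hs
    rw [Metric.mem_ball, Real.dist_eq] at hs
    linarith [abs_sub_abs_le_abs_sub s t]
  have hm := fun s => aestronglyMeasurable_amplitude hb.1 hz.1 hy s
  have := (hasDerivAt_integral_of_dominated_loc_of_deriv_le (μ := volume)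
    (F := fun s ν => ‖amplitude b z₀ y ν s‖ ^ 2)
    (F' := fun s ν => -2 * y s * (b ν * (amplitude b z₀ y ν s).im))
    (bound := fun ν => 2 * M * (|b ν| * (‖z₀ ν‖ + |b ν| * M)))
    (Metric.ball_mem_nhds t one_pos) (Eventually.of_forall fun s => (hm s).norm.pow 2)
    (memLp_amplitude hb hz hy t).norm.integrable_sq
    ((integrable_mul_amplitude_im hb hb hz hy t).const_mul _).aestronglyMeasurable
    (ae_of_all _ fun ν s hs => ?_)
    ((hb.norm.integrable_mul (hz.norm.add (hb.norm.mul_const M))).const_mul _)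
    (ae_of_all _ fun ν s hs => ?_)).2
  · rwa [integral_const_mul] at this
  · have h1 := norm_amplitude_le (b := b) (z₀ := z₀) (hM ν s (hball s hs))
    have h2 := (Complex.abs_im_le_norm (amplitude b z₀ y ν s)).trans h1
    rw [norm_mul, norm_mul, norm_mul, Real.norm_eq_abs, Real.norm_eq_abs, Real.norm_eq_abs,
      Real.norm_eq_abs, abs_neg, abs_two]
    have := hyM s (hball s hs)
    gcongr
  · refine (hasDerivAt_amplitude hy ν s).norm_sq.congr_deriv ?_
    rw [Complex.inner]
    simp
    ring

/-- The derivative of the pairing of the modes with a profile `c`. The forcing drops out, since it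
is purely imaginary. -/
lemma hasDerivAt_integral_mul_re {c : ℝ → ℝ} (hc : MemLp c 2) (hc' : MemLp (fun ν => c ν * ν) 2)
    (hb : MemLp b 2) (hz : MemLp z₀ 2) (hy : Continuous y) (t : ℝ) :
    HasDerivAt (fun t => ∫ ν, c ν * (amplitude b z₀ y ν t).re)
      (-∫ ν, c ν * ν * (amplitude b z₀ y ν t).im) t := by
  obtain ⟨M, hM0, hyM, hM⟩ := exists_bound_truncFourier hy (|t| + 1)
  have hball : ∀ s ∈ Metric.ball t 1, |s| ≤ |t| + 1 := by
    intro s hs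
    rw [Metric.mem_ball, Real.dist_eq] at hs
    linarith [abs_sub_abs_le_abs_sub s t]
  have := (hasDerivAt_integral_of_dominated_loc_of_deriv_le (μ := volume)
    (F := fun s ν => c ν * (amplitude b z₀ y ν s).re)
    (F' := fun s ν => -(c ν * ν * (amplitude b z₀ y ν s).im))
    (bound := fun ν => |c ν * ν| * (‖z₀ ν‖ + |b ν| * M))
    (Metric.ball_mem_nhds t one_pos)
    (Eventually.of_forall fun s => hc.1.mul (memLp_amplitude hb hz hy s).re.1)
    (hc.integrable_mul (memLp_amplitude hb hz hy t).re)
    (integrable_mul_amplitude_im hc' hb hz hy t).neg.aestronglyMeasurable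
    (ae_of_all _ fun ν s hs => ?_)
    (hc'.norm.integrable_mul (hz.norm.add (hb.norm.mul_const M)))
    (ae_of_all _ fun ν s hs => ?_)).2
  · rwa [integral_neg] at this
  · have h1 := norm_amplitude_le (b := b) (z₀ := z₀) (hM ν s (hball s hs))
    have h2 := (Complex.abs_im_le_norm (amplitude b z₀ y ν s)).trans h1
    rw [norm_neg, norm_mul, Real.norm_eq_abs, Real.norm_eq_abs]
    gcongr
  · have h := Complex.reCLM.hasFDerivAt.comp_hasDerivAt s
      (hasDerivAt_amplitude (b := b) (z₀ := z₀) hy ν s)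
    refine (h.const_mul (c ν)).congr_deriv ?_
    simp
    ring

end Modes

/-! ### The reduced motion -/

/-- The equation of motion after elimination of the thermostat: a particle `x` in the potential `U`
is driven by modes with amplitudes `z`, which are in turn driven by the velocity of the particle
through the coupling `b`. The coupling is continuous and nonzero away from frequency zero. -/
structure IsReducedMotion (b : ℝ → ℝ) (z₀ : ℝ → ℂ) (U x : ℝ → ℝ) : Prop where
  memLp_coupling : MemLp b 2
  continuousOn_coupling : ContinuousOn b {0}ᶜ
  coupling_ne_zero : ∀ ν ≠ 0, b ν ≠ 0
  memLp_initial : MemLp z₀ 2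
  differentiable_potential : Differentiable ℝ U
  continuous_deriv_potential : Continuous (deriv U)
  bddBelow : BddBelow (Set.range U)
  isCompact_sublevel : ∀ E, IsCompact {u | U u ≤ E}
  differentiable : Differentiable ℝ x
  differentiable_deriv : Differentiable ℝ (deriv x)
  equation : ∀ t, deriv (deriv x) t + deriv U (x t)
    = ∫ ν, b ν * (amplitude b z₀ (deriv x) ν t).im

/-- Young's inequality with a weight `r`. -/
lemma abs_integral_mul_le {c q : ℝ → ℝ} (hc : MemLp c 2) (hq : MemLp q 2) {r : ℝ} (hr : 0 < r) :
    |∫ ν, c ν * q ν| ≤ (r * ∫ ν, c ν ^ 2) + r⁻¹ * ∫ ν, q ν ^ 2 := by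
  rw [← integral_const_mul, ← integral_const_mul,
    ← integral_add (hc.integrable_sq.const_mul r) (hq.integrable_sq.const_mul r⁻¹)]
  refine norm_integral_le_of_norm_le (f := fun ν => c ν * q ν)
    ((hc.integrable_sq.const_mul r).add (hq.integrable_sq.const_mul r⁻¹)) (ae_of_all _ fun ν => ?_)
  rw [Real.norm_eq_abs, abs_le]
  have h1 : r * c ν ^ 2 + r⁻¹ * q ν ^ 2 + c ν * q ν
      = r * (c ν + r⁻¹ * q ν / 2) ^ 2 + r⁻¹ * q ν ^ 2 * (3 / 4) := by field_simp; ring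
  have h2 : r * c ν ^ 2 + r⁻¹ * q ν ^ 2 - c ν * q ν
      = r * (c ν - r⁻¹ * q ν / 2) ^ 2 + r⁻¹ * q ν ^ 2 * (3 / 4) := by field_simp; ring
  have h3 : 0 ≤ r * (c ν + r⁻¹ * q ν / 2) ^ 2 + r⁻¹ * q ν ^ 2 * (3 / 4) := by positivity
  have h4 : 0 ≤ r * (c ν - r⁻¹ * q ν / 2) ^ 2 + r⁻¹ * q ν ^ 2 * (3 / 4) := by positivity
  constructor <;> linarith

/-- The frequencies close to zero carry little of the coupling. -/
lemma exists_integral_indicator_sq_lt {b : ℝ → ℝ} (hb : MemLp b 2) {ε : ℝ} (hε : 0 < ε) :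
    ∃ δ > 0, ∫ ν, ({ν : ℝ | |ν| ≤ δ}.indicator b ν) ^ 2 < ε := by
  have hms : ∀ δ : ℝ, MeasurableSet {ν : ℝ | |ν| ≤ δ} := fun δ =>
    measurableSet_le measurable_norm measurable_const
  have hlim : Tendsto (fun n : ℕ => ∫ ν, ({ν : ℝ | |ν| ≤ 1 / ((n : ℝ) + 1)}.indicator b ν) ^ 2)
      atTop (𝓝 (∫ _ : ℝ, (0 : ℝ))) := by
    refine tendsto_integral_of_dominated_convergence (fun ν => b ν ^ 2)
      (fun n => (hb.1.indicator (hms _)).pow 2) hb.integrable_sq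
      (fun n => ae_of_all _ fun ν => ?_) ?_
    · by_cases h : ν ∈ {ν : ℝ | |ν| ≤ 1 / ((n : ℝ) + 1)}
      · rw [Set.indicator_of_mem h, Real.norm_of_nonneg (sq_nonneg _)]
      · rw [Set.indicator_of_notMem h]
        simp [sq_nonneg]
    · filter_upwards [Measure.ae_ne volume (0 : ℝ)] with ν hν
      refine tendsto_const_nhds.congr' ?_
      filter_upwards [tendsto_one_div_add_atTop_nhds_zero_nat.eventually
        (gt_mem_nhds (abs_pos.2 hν))] with n hn
      rw [Set.indicator_of_notMem (by simpa using hn)]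
      simp
  rw [integral_zero] at hlim
  obtain ⟨n, hn⟩ := (hlim.eventually (gt_mem_nhds hε)).exists
  exact ⟨1 / ((n : ℝ) + 1), by positivity, hn⟩

namespace IsReducedMotion

variable {b : ℝ → ℝ} {z₀ : ℝ → ℂ} {U x : ℝ → ℝ}

lemma continuous_velocity (h : IsReducedMotion b z₀ U x) : Continuous (deriv x) :=
  h.differentiable_deriv.continuous

/-- Conservation of the total energy. -/
lemma energy_eq (h : IsReducedMotion b z₀ U x) (t : ℝ) :
    deriv x t ^ 2 / 2 + U (x t) + (∫ ν, ‖amplitude b z₀ (deriv x) ν t‖ ^ 2) / 2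
      = deriv x 0 ^ 2 / 2 + U (x 0) + (∫ ν, ‖amplitude b z₀ (deriv x) ν 0‖ ^ 2) / 2 := by
  have hd : ∀ t, HasDerivAt (fun t => deriv x t ^ 2 / 2 + U (x t)
      + (∫ ν, ‖amplitude b z₀ (deriv x) ν t‖ ^ 2) / 2) 0 t := by
    intro t
    have h1 := ((h.differentiable_deriv t).hasDerivAt.pow 2).div_const 2
    have h2 := (h.differentiable_potential (x t)).hasDerivAt.comp t (h.differentiable t).hasDerivAt
    have h3 := (hasDerivAt_integral_norm_sq h.memLp_coupling h.memLp_initial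
      h.continuous_velocity t).div_const 2
    refine ((h1.add h2).add h3).congr_deriv ?_
    rw [← h.equation t]
    ring
  exact is_const_of_deriv_eq_zero (fun t => (hd t).differentiableAt) (fun t => (hd t).deriv) t 0

/-- Position, velocity and the energy of the modes are bounded for all times. -/
lemma exists_bound (h : IsReducedMotion b z₀ U x) :
    ∃ C, 0 ≤ C ∧ ∀ t, |x t| ≤ C ∧ |deriv x t| ≤ C ∧
      ∫ ν, ‖amplitude b z₀ (deriv x) ν t‖ ^ 2 ≤ C := by
  obtain ⟨m, hm⟩ := h.bddBelow
  have hm' : ∀ t, m ≤ U (x t) := fun t => hm ⟨x t, rfl⟩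
  set E := deriv x 0 ^ 2 / 2 + U (x 0) + (∫ ν, ‖amplitude b z₀ (deriv x) ν 0‖ ^ 2) / 2 with hE
  have hN : ∀ t, 0 ≤ ∫ ν, ‖amplitude b z₀ (deriv x) ν t‖ ^ 2 := fun t =>
    integral_nonneg fun ν => by positivity
  obtain ⟨B, hB⟩ := (h.isCompact_sublevel E).isBounded.exists_norm_le
  refine ⟨|B| + (2 * |E - m| + 1), by positivity, fun t => ⟨?_, ?_, ?_⟩⟩
  · have h1 : x t ∈ {u | U u ≤ E} := by
      simp only [Set.mem_ofPred_eq]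
      nlinarith [h.energy_eq t, hN t, sq_nonneg (deriv x t)]
    have h2 := hB _ h1
    rw [Real.norm_eq_abs] at h2
    linarith [le_abs_self B, abs_nonneg (E - m)]
  · have h1 : deriv x t ^ 2 ≤ 2 * |E - m| := by
      linarith [h.energy_eq t, hN t, hm' t, le_abs_self (E - m)]
    have h2 : |deriv x t| ≤ 2 * |E - m| + 1 := by
      rw [← sq_abs] at h1
      nlinarith [sq_nonneg (|deriv x t| - 1)]
    linarith [abs_nonneg B]
  · have h1 : ∫ ν, ‖amplitude b z₀ (deriv x) ν t‖ ^ 2 ≤ 2 * |E - m| := by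
      linarith [h.energy_eq t, hm' t, le_abs_self (E - m), sq_nonneg (deriv x t)]
    linarith [abs_nonneg B]

lemma integral_im_sq_le (h : IsReducedMotion b z₀ U x) (t : ℝ) :
    ∫ ν, (amplitude b z₀ (deriv x) ν t).im ^ 2
      ≤ ∫ ν, ‖amplitude b z₀ (deriv x) ν t‖ ^ 2 := by
  have hz := memLp_amplitude h.memLp_coupling h.memLp_initial h.continuous_velocity t
  refine integral_mono hz.im.integrable_sq hz.norm.integrable_sq fun ν => ?_
  simpa using pow_le_pow_left₀ (abs_nonneg _)
    (Complex.abs_im_le_norm (amplitude b z₀ (deriv x) ν t)) 2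

lemma integral_re_sq_le (h : IsReducedMotion b z₀ U x) (t : ℝ) :
    ∫ ν, (amplitude b z₀ (deriv x) ν t).re ^ 2
      ≤ ∫ ν, ‖amplitude b z₀ (deriv x) ν t‖ ^ 2 := by
  have hz := memLp_amplitude h.memLp_coupling h.memLp_initial h.continuous_velocity t
  refine integral_mono hz.re.integrable_sq hz.norm.integrable_sq fun ν => ?_
  simpa using pow_le_pow_left₀ (abs_nonneg _)
    (Complex.abs_re_le_norm (amplitude b z₀ (deriv x) ν t)) 2

/-- The velocity is Lipschitz, because potential force and thermostat force are bounded. -/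
lemma exists_lipschitz (h : IsReducedMotion b z₀ U x) :
    ∃ L, ∀ s t, |deriv x s - deriv x t| ≤ L * |s - t| := by
  obtain ⟨C, hC0, hC⟩ := h.exists_bound
  obtain ⟨D, hD⟩ := (isCompact_Icc (a := -C) (b := C)).exists_bound_of_continuousOn
    h.continuous_deriv_potential.continuousOn
  refine ⟨1 * (∫ ν, b ν ^ 2) + 1⁻¹ * C + D, fun s t => ?_⟩
  refine Convex.norm_image_sub_le_of_norm_deriv_le (s := Set.univ) (f := deriv x)
    (fun u _ => h.differentiable_deriv u) (fun u _ => ?_) convex_univ (Set.mem_univ t)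
    (Set.mem_univ s)
  have hz := memLp_amplitude h.memLp_coupling h.memLp_initial h.continuous_velocity u
  have h1 := abs_integral_mul_le h.memLp_coupling hz.im one_pos
  have h2 := hD (x u) (abs_le.1 (hC u).1)
  have h3 := (h.integral_im_sq_le u).trans (hC u).2.2
  have h4 : deriv (deriv x) u = (∫ ν, b ν * (amplitude b z₀ (deriv x) ν u).im) - deriv U (x u) := by
    linarith [h.equation u]
  rw [h4]
  refine (norm_sub_le _ _).trans (add_le_add (h1.trans ?_) h2)
  simp only [RCLike.im_to_complex]
  linarith

/-- The velocity tends to zero: the modes absorb only a finite amount of energy. -/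
lemma tendsto_velocity (h : IsReducedMotion b z₀ U x) :
    Tendsto (deriv x) (cocompact ℝ) (𝓝 0) := by
  obtain ⟨C, hC0, hC⟩ := h.exists_bound
  obtain ⟨L, hL⟩ := h.exists_lipschitz
  have hzi := fun t => (memLp_amplitude h.memLp_coupling h.memLp_initial
    h.continuous_velocity t).norm.integrable_sq
  have hle : ∀ T ν : ℝ,
      b ν ^ 2 * ‖∫ s in (-T)..T, Complex.exp (-(Complex.I * ν * s)) * ((deriv x s : ℝ) : ℂ)‖ ^ 2
      ≤ 2 * ‖amplitude b z₀ (deriv x) ν T‖ ^ 2 + 2 * ‖amplitude b z₀ (deriv x) ν (-T)‖ ^ 2 := by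
    intro T ν
    have hyc := h.continuous_velocity
    have hc : Continuous fun s : ℝ => Complex.exp (-(Complex.I * ν * s))
        * ((deriv x s : ℝ) : ℂ) := by
      fun_prop
    have h1 : ∫ s in (-T)..T, Complex.exp (-(Complex.I * ν * s)) * ((deriv x s : ℝ) : ℂ)
        = truncFourier (deriv x) ν T - truncFourier (deriv x) ν (-T) :=
      (intervalIntegral.integral_interval_sub_left (hc.intervalIntegrable _ _)
        (hc.intervalIntegrable _ _)).symm
    rw [norm_amplitude, norm_amplitude, h1]
    set A := z₀ ν - Complex.I * b ν * truncFourier (deriv x) ν T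
    set A' := z₀ ν - Complex.I * b ν * truncFourier (deriv x) ν (-T)
    have h2 : b ν ^ 2 * ‖truncFourier (deriv x) ν T - truncFourier (deriv x) ν (-T)‖ ^ 2
        = ‖A' - A‖ ^ 2 := by
      rw [show A' - A = Complex.I * b ν
        * (truncFourier (deriv x) ν T - truncFourier (deriv x) ν (-T)) by simp only [A, A']; ring,
        norm_mul, norm_mul, Complex.norm_I, one_mul, Complex.norm_real, mul_pow,
        Real.norm_eq_abs, sq_abs]
    rw [h2]
    have h3 := norm_sub_le A' A
    nlinarith [norm_nonneg (A' - A), sq_nonneg (‖A'‖ - ‖A‖)]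
  have hm : ∀ T : ℝ, AEStronglyMeasurable fun ν : ℝ =>
      b ν ^ 2 * ‖∫ s in (-T)..T, Complex.exp (-(Complex.I * ν * s))
        * ((deriv x s : ℝ) : ℂ)‖ ^ 2 := by
    intro T
    have hyc := h.continuous_velocity
    have := intervalIntegral.continuous_parametric_intervalIntegral_of_continuous' (μ := volume)
      (f := fun (ν s : ℝ) => Complex.exp (-(Complex.I * ν * s)) * ((deriv x s : ℝ) : ℂ))
      (by fun_prop) (-T) T
    exact (h.memLp_coupling.1.pow 2).mul (this.aestronglyMeasurable.norm.pow 2)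
  have hfin : ∀ T : ℝ, Integrable fun ν : ℝ =>
      b ν ^ 2 * ‖∫ s in (-T)..T, Complex.exp (-(Complex.I * ν * s))
        * ((deriv x s : ℝ) : ℂ)‖ ^ 2 := fun T =>
    (((hzi T).const_mul 2).add ((hzi (-T)).const_mul 2)).mono' (hm T) (ae_of_all _ fun ν => by
      rw [Real.norm_of_nonneg (by positivity)]; exact hle T ν)
  refine tendsto_zero_of_energy_bound (b := b) (C := 4 * C)
    (fun t => (h.differentiable t).hasDerivAt) (fun t => (hC t).1) (fun t => (hC t).2.1) hL
    h.continuousOn_coupling h.coupling_ne_zero (fun T _ => hfin T) fun T _ => ?_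
  refine (integral_mono (hfin T) (((hzi T).const_mul 2).add ((hzi (-T)).const_mul 2))
    (hle T)).trans ?_
  simp only [Pi.add_apply]
  rw [integral_add ((hzi T).const_mul 2) ((hzi (-T)).const_mul 2), integral_const_mul,
    integral_const_mul]
  linarith [(hC T).2.2, (hC (-T)).2.2]

/-- The potential force along the motion tends to zero. -/
lemma tendsto_force (h : IsReducedMotion b z₀ U x) :
    Tendsto (fun t => deriv U (x t)) (cocompact ℝ) (𝓝 0) := by
  obtain ⟨C, hC0, hC⟩ := h.exists_bound
  have hz := fun t => memLp_amplitude h.memLp_coupling h.memLp_initial h.continuous_velocity t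
  rw [Metric.tendsto_nhds]
  intro ε hε
  -- Split off the frequencies `|ν| ≤ δ`, whose contribution to the force is small.
  set r : ℝ := 8 * (C + 1) / ε with hr
  have hr0 : 0 < r := by positivity
  obtain ⟨δ, hδ, hδb⟩ := exists_integral_indicator_sq_lt h.memLp_coupling
    (ε := ε / (8 * r)) (by positivity)
  set lo : ℝ → ℝ := {ν : ℝ | |ν| ≤ δ}.indicator b with hlo
  set c : ℝ → ℝ := {ν : ℝ | |ν| ≤ δ}ᶜ.indicator (fun ν => b ν / ν) with hc
  have hms : MeasurableSet {ν : ℝ | |ν| ≤ δ} := measurableSet_le measurable_norm measurable_const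
  have hloL : MemLp lo 2 := h.memLp_coupling.indicator hms
  have hcL : MemLp c 2 := by
    refine MemLp.mono' (h.memLp_coupling.norm.const_mul δ⁻¹)
      ((h.memLp_coupling.1.div₀ measurable_id.aestronglyMeasurable).indicator hms.compl)
      (ae_of_all _ fun ν => ?_)
    by_cases hν : |ν| ≤ δ
    · rw [hc, Set.indicator_of_notMem (by simpa using hν), norm_zero]
      positivity
    · rw [hc, Set.indicator_of_mem (by simpa using hν), norm_div, div_eq_inv_mul]
      rw [not_le] at hν
      exact mul_le_mul_of_nonneg_right (inv_anti₀ hδ hν.le) (norm_nonneg _)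
  have hcν : ∀ ν, c ν * ν = b ν - lo ν := by
    intro ν
    by_cases hν : |ν| ≤ δ
    · have hν' : ν ∈ {ν : ℝ | |ν| ≤ δ} := by simpa using hν
      rw [hc, hlo, Set.indicator_of_notMem (by simpa using hν), Set.indicator_of_mem hν']
      ring
    · have hν0 : ν ≠ 0 := by rintro rfl; exact hν (by simpa using hδ.le)
      have hν' : ν ∉ {ν : ℝ | |ν| ≤ δ} := by simpa using hν
      rw [hc, hlo, Set.indicator_of_mem (by simpa using hν), Set.indicator_of_notMem hν']
      field_simp
      ring
  have hcL' : MemLp (fun ν => c ν * ν) 2 := by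
    simp only [hcν]
    exact h.memLp_coupling.sub hloL
  -- The force of the remaining modes is, up to sign, the derivative of the bounded integral in `Q`.
  set Q : ℝ → ℝ := fun t => deriv x t + ∫ ν, c ν * (amplitude b z₀ (deriv x) ν t).re with hQ
  set e : ℝ → ℝ := fun t => ∫ ν, lo ν * (amplitude b z₀ (deriv x) ν t).im with he
  have hQd : ∀ t, HasDerivAt Q (e t - deriv U (x t)) t := by
    intro t
    refine ((h.differentiable_deriv t).hasDerivAt.add (hasDerivAt_integral_mul_re hcL hcL'
      h.memLp_coupling h.memLp_initial h.continuous_velocity t)).congr_deriv ?_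
    simp only [hcν, sub_mul]
    rw [integral_sub (integrable_mul_amplitude_im h.memLp_coupling h.memLp_coupling
      h.memLp_initial h.continuous_velocity t) (integrable_mul_amplitude_im hloL h.memLp_coupling
      h.memLp_initial h.continuous_velocity t), ← h.equation t]
    simp only [he]
    ring
  have hesmall : ∀ t, |e t| ≤ ε / 4 := by
    intro t
    refine (abs_integral_mul_le hloL (hz t).im hr0).trans ?_
    have h1 := (h.integral_im_sq_le t).trans (hC t).2.2
    have h2 : r * ∫ ν, lo ν ^ 2 ≤ ε / 8 := by
      rw [lt_div_iff₀ (by positivity)] at hδb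
      linarith
    have h3 : r⁻¹ * ∫ ν, RCLike.im (amplitude b z₀ (deriv x) ν t) ^ 2 ≤ ε / 8 := by
      rw [inv_mul_le_iff₀ hr0, hr]
      simp only [RCLike.im_to_complex]
      refine h1.trans ?_
      field_simp
      linarith
    linarith
  set Q₀ : ℝ := C + (1 * (∫ ν, c ν ^ 2) + 1⁻¹ * C) with hQ₀
  have hQ₀0 : 0 ≤ Q₀ := by
    have : 0 ≤ ∫ ν, c ν ^ 2 := integral_nonneg fun ν => by positivity
    rw [hQ₀]; linarith
  have hQb : ∀ t, |Q t| ≤ Q₀ := by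
    intro t
    have h1 := (h.integral_re_sq_le t).trans (hC t).2.2
    refine (abs_add_le _ _).trans (add_le_add (hC t).2.1
      ((abs_integral_mul_le hcL (hz t).re one_pos).trans ?_))
    simp only [RCLike.re_to_complex]
    linarith
  -- Over a time window of this length the mean value theorem makes the derivative of `Q` small.
  set W : ℝ := 8 * (Q₀ + 1) / ε with hW
  have hW0 : 0 < W := by positivity
  -- Late enough, the position changes by less than `η` over a time window of length `W`.
  have huc := isCompact_Icc (a := -C) (b := C) |>.uniformContinuousOn_of_continuous
    h.continuous_deriv_potential.continuousOn
  rw [Metric.uniformContinuousOn_iff] at huc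
  obtain ⟨η, hη, hηU⟩ := huc (ε / 2) (by positivity)
  have hv := h.tendsto_velocity
  rw [Metric.tendsto_nhds] at hv
  obtain ⟨R, hR⟩ := eventually_cocompact_iff.1 (hv (η / W) (by positivity))
  rw [eventually_cocompact_iff]
  refine ⟨R + W, fun t ht => ?_⟩
  have hwin : ∀ s, t < s → s < t + W → |deriv x s| < η / W := by
    intro s hs1 hs2
    have := hR s (by
      have h1 := abs_sub_abs_le_abs_sub t s
      have h2 : |t - s| ≤ W := by rw [abs_le]; constructor <;> linarith
      linarith)
    rwa [dist_zero_right] at this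
  obtain ⟨s, hs, hsQ⟩ := exists_hasDerivAt_eq_slope Q (fun s => e s - deriv U (x s))
    (show t < t + W by linarith) (fun s _ => (hQd s).continuousAt.continuousWithinAt)
    (fun s _ => hQd s)
  obtain ⟨u, hu, hux⟩ := exists_hasDerivAt_eq_slope x (deriv x) hs.1
    (fun s _ => (h.differentiable s).continuousAt.continuousWithinAt)
    (fun s _ => (h.differentiable s).hasDerivAt)
  have hUs : |deriv U (x s)| ≤ ε / 2 := by
    have h1 : |(Q (t + W) - Q t) / (t + W - t)| ≤ ε / 4 := by
      rw [add_sub_cancel_left, abs_div, abs_of_pos hW0, div_le_iff₀ hW0]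
      have h2 : ε / 4 * W = 2 * (Q₀ + 1) := by rw [hW]; field_simp; ring
      have h3 := abs_sub (Q (t + W)) (Q t)
      linarith [hQb (t + W), hQb t]
    rw [← hsQ] at h1
    have h2 := abs_sub_abs_le_abs_sub (deriv U (x s)) (e s)
    rw [abs_sub_comm] at h2
    linarith [hesmall s]
  have hxs : dist (x t) (x s) < η := by
    rw [dist_comm, Real.dist_eq]
    have h1 : x s - x t = deriv x u * (s - t) := by
      rw [hux]; field_simp [(sub_pos.2 hs.1).ne']
    have h2 := hwin u hu.1 (hu.2.trans hs.2)
    rw [lt_div_iff₀ hW0] at h2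
    rw [h1, abs_mul, abs_of_pos (sub_pos.2 hs.1)]
    refine lt_of_le_of_lt (mul_le_mul_of_nonneg_left ?_ (abs_nonneg _)) h2
    linarith [hs.2]
  have h1 := hηU (x t) (abs_le.1 (hC t).1) (x s) (abs_le.1 (hC s).1) hxs
  rw [Real.dist_eq] at h1
  rw [dist_zero_right, Real.norm_eq_abs]
  linarith [abs_sub_abs_le_abs_sub (deriv U (x t)) (deriv U (x s))]

end IsReducedMotion

/-- A bounded path along which `F` tends to zero converges to a zero of `F`, provided that the zeros
of `F` contain no interval: otherwise the path would traverse some interval infinitely often. -/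
lemma exists_tendsto_of_tendsto_comp_zero {F x : ℝ → ℝ} {C : ℝ} (hF : Continuous F)
    (hx : Continuous x) (hC : ∀ t, |x t| ≤ C) (hFx : Tendsto (fun t => F (x t)) atTop (𝓝 0))
    (hF0 : ∀ a b : ℝ, a < b → ∃ y ∈ Set.Ioo a b, F y ≠ 0) :
    ∃ l, Tendsto x atTop (𝓝 l) ∧ F l = 0 := by
  obtain ⟨l, hl⟩ := tendsto_of_no_upcrossings (f := atTop) (u := x) dense_univ
    (fun a _ b _ hab ⟨ha, hb⟩ => by
      -- A level `y` with `F y ≠ 0` between `a` and `b` is crossed at arbitrarily late times.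
      obtain ⟨y, hy, hy0⟩ := hF0 a b hab
      have hfreq : ∃ᶠ t in atTop, F (x t) = F y := by
        rw [frequently_atTop]
        intro T
        obtain ⟨t₁, ht₁, h₁⟩ := frequently_atTop.1 ha T
        obtain ⟨t₂, ht₂, h₂⟩ := frequently_atTop.1 hb T
        obtain ⟨s, hs, hsy⟩ := intermediate_value_uIcc (a := t₁) (b := t₂) hx.continuousOn
          (Set.mem_uIcc.2 (Or.inl ⟨(h₁.trans hy.1).le, (hy.2.trans h₂).le⟩))
        exact ⟨s, (le_min ht₁ ht₂).trans hs.1, by rw [hsy]⟩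
      have hne := hFx.eventually (isOpen_ne.mem_nhds hy0.symm)
      obtain ⟨t, h1, h2⟩ := (hfreq.and_eventually hne).exists
      exact h2 h1)
    (isBoundedUnder_of ⟨C, fun t => (abs_le.1 (hC t)).2⟩)
    (isBoundedUnder_of ⟨-C, fun t => (abs_le.1 (hC t)).1⟩)
  exact ⟨l, hl, tendsto_nhds_unique ((hF.tendsto l).comp hl) hFx⟩

/-- The position converges to critical points of the potential in both time directions. -/
lemma IsReducedMotion.exists_tendsto {b : ℝ → ℝ} {z₀ : ℝ → ℂ} {U x : ℝ → ℝ}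
    (h : IsReducedMotion b z₀ U x)
    (hU : ∀ a b : ℝ, a < b → ∃ y ∈ Set.Ioo a b, deriv U y ≠ 0) :
    ∃ l m : ℝ, Tendsto x atTop (𝓝 l) ∧ Tendsto x atBot (𝓝 m) ∧ deriv U l = 0 ∧ deriv U m = 0 := by
  obtain ⟨C, -, hC⟩ := h.exists_bound
  have hf := h.tendsto_force
  obtain ⟨l, hl, hl0⟩ := exists_tendsto_of_tendsto_comp_zero h.continuous_deriv_potential
    h.differentiable.continuous (fun t => (hC t).1) (hf.mono_left atTop_le_cocompact) hU
  obtain ⟨m, hm, hm0⟩ := exists_tendsto_of_tendsto_comp_zero (x := fun t => x (-t))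
    h.continuous_deriv_potential (h.differentiable.continuous.comp continuous_neg)
    (fun t => (hC (-t)).1)
    ((hf.mono_left atBot_le_cocompact).comp tendsto_neg_atTop_atBot) hU
  refine ⟨l, m, hl, ?_, hl0, hm0⟩
  simpa [Function.comp_def] using hm.comp tendsto_neg_atBot_atTop

/-! ### Elimination of the thermostat -/

section Elimination

variable {ρ κ V₀ : ℝ → ℝ} {x₀ x₁ : ℝ} {ξ₀ ξ₁ : ℝ → ℝ} {x : ℝ → ℝ} {ξ : ℝ → ℝ → ℝ}

/-- The coupling `b(ν) = â(ν) / ν` of the modes to the velocity. -/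
noncomputable def coupling (ρ κ : ℝ → ℝ) (ν : ℝ) : ℝ := aHat ρ κ ν / ν

/-- The initial amplitude `√ρ (ξ₁ + iνξ₀) - i b x₀` of the mode of frequency `ν`. -/
noncomputable def initialAmplitude (ρ κ : ℝ → ℝ) (x₀ : ℝ) (ξ₀ ξ₁ : ℝ → ℝ) (ν : ℝ) : ℂ :=
  Real.sqrt (ρ ν) * (ξ₁ ν + Complex.I * ν * ξ₀ ν) - Complex.I * coupling ρ κ ν * x₀

lemma aHat_sq (h1 : H1 ρ κ V₀) (ν : ℝ) : aHat ρ κ ν ^ 2 = κ ν ^ 2 / ρ ν := by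
  rw [aHat, div_pow, Real.sq_sqrt (h1.density_nonneg ν)]

lemma coupling_sq (h1 : H1 ρ κ V₀) (ν : ℝ) :
    coupling ρ κ ν ^ 2 = κ ν ^ 2 / (ρ ν * ν ^ 2) := by
  rw [coupling, div_pow, aHat_sq h1, div_div]

lemma memLp_coupling (h1 : H1 ρ κ V₀) (h2 : H2 ρ κ) (h5 : H5 ρ κ) : MemLp (coupling ρ κ) 2 := by
  have hm : AEStronglyMeasurable (coupling ρ κ) :=
    h5.differentiable.continuous.aestronglyMeasurable.div₀ measurable_id.aestronglyMeasurable
  rw [memLp_two_iff_integrable_sq hm]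
  simpa only [coupling_sq h1] using h2.integrable_K

lemma memLp_initialAmplitude (h1 : H1 ρ κ V₀) (h2 : H2 ρ κ) (h4 : H4 ρ ξ₀ ξ₁) (h5 : H5 ρ κ)
    (x₀ : ℝ) : MemLp (initialAmplitude ρ κ x₀ ξ₀ ξ₁) 2 := by
  have hb := memLp_coupling h1 h2 h5
  refine MemLp.sub ?_ ?_
  · have hm : AEStronglyMeasurable (fun ν : ℝ =>
        (Real.sqrt (ρ ν) : ℂ) * (ξ₁ ν + Complex.I * ν * ξ₀ ν)) := by
      have e1 := Complex.measurable_ofReal.comp_aemeasurable h1.aemeasurable_density.sqrt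
      have e2 := Complex.measurable_ofReal.comp_aemeasurable h4.aemeasurable_pos
      have e3 := Complex.measurable_ofReal.comp_aemeasurable h4.aemeasurable_vel
      have e4 : AEMeasurable fun ν : ℝ => Complex.I * (ν : ℂ) :=
        (Complex.measurable_ofReal.const_mul _).aemeasurable
      exact (e1.mul (e3.add (e4.mul e2))).aestronglyMeasurable
    rw [memLp_two_iff_integrable_sq_norm hm]
    refine h4.integrable.congr (ae_of_all _ fun ν => ?_)
    have h6 : (ξ₁ ν : ℂ) + Complex.I * ν * ξ₀ ν
        = (ξ₁ ν : ℝ) + ((ν * ξ₀ ν : ℝ) : ℂ) * Complex.I := by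
      push_cast; ring
    simp only [norm_mul, mul_pow, Complex.norm_real, Real.norm_eq_abs, sq_abs,
      Real.sq_sqrt (h1.density_nonneg ν)]
    rw [h6, ← Complex.normSq_eq_norm_sq, Complex.normSq_add_mul_I]
    ring
  · have hm : AEStronglyMeasurable (fun ν : ℝ => Complex.I * (coupling ρ κ ν : ℂ) * (x₀ : ℂ)) :=
      ((Complex.continuous_ofReal.comp_aestronglyMeasurable hb.1).const_mul _).mul_const _
    refine MemLp.mono' (hb.norm.mul_const |x₀|) hm (ae_of_all _ fun ν => ?_)
    simp

lemma contDiff_effectivePotential (h1 : H1 ρ κ V₀) :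
    ContDiff ℝ ∞ (effectivePotential ρ κ V₀) :=
  h1.smooth.sub ((contDiff_const.mul (contDiff_id.pow 2)).div_const 2)

lemma deriv_effectivePotential (h1 : H1 ρ κ V₀) (u : ℝ) :
    deriv (effectivePotential ρ κ V₀) u = deriv V₀ u - K ρ κ * u := by
  have h2 : HasDerivAt V₀ (deriv V₀ u) u :=
    ((h1.smooth.differentiable (by simp)) u).hasDerivAt
  have h3 := h2.sub ((((hasDerivAt_id u).pow 2).const_mul (K ρ κ)).div_const 2)
  refine (h3.congr_deriv ?_).deriv
  simp; ring

/-- Variation of constants for a single mode: the complex amplitude of a solution `q` of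
`r (q'' + ν² q) = k y` is given by `amplitude`. -/
lemma amplitude_eq_of_mode {r k b ν : ℝ} {y q : ℝ → ℝ} (hr : 0 < r) (hν : ν ≠ 0)
    (hb : b = k / Real.sqrt r / ν) (hx : Differentiable ℝ y) (hx' : Continuous (deriv y))
    (hq : Differentiable ℝ q) (hq' : Differentiable ℝ (deriv q))
    (heq : ∀ t, r * (deriv (deriv q) t + ν ^ 2 * q t) = k * y t) (t : ℝ) :
    (Real.sqrt r : ℂ) * (deriv q t + Complex.I * ν * q t) - Complex.I * b * y t
      = amplitude (fun _ => b) (fun _ => (Real.sqrt r : ℂ) * (deriv q 0 + Complex.I * ν * q 0)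
        - Complex.I * b * y 0) (deriv y) ν t := by
  set g : ℝ → ℂ := fun t => (Real.sqrt r : ℂ) * (deriv q t + Complex.I * ν * q t)
    - Complex.I * b * y t with hg
  have hs : Real.sqrt r ≠ 0 := (Real.sqrt_pos.2 hr).ne'
  have hgd : ∀ t, HasDerivAt g (Complex.I * ν * g t - Complex.I * b * deriv y t) t := by
    intro t
    have e1 := ((hq' t).hasDerivAt.ofReal_comp).add
      ((hq t).hasDerivAt.ofReal_comp.const_mul (Complex.I * ν))
    have e2 := (e1.const_mul (Real.sqrt r : ℂ)).sub
      ((hx t).hasDerivAt.ofReal_comp.const_mul (Complex.I * b))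
    refine e2.congr_deriv ?_
    have e3 : Real.sqrt r * (deriv (deriv q) t + ν ^ 2 * q t) = b * ν * y t := by
      have e4 : Real.sqrt r * (Real.sqrt r * (deriv (deriv q) t + ν ^ 2 * q t)) = k * y t := by
        rw [← mul_assoc, Real.mul_self_sqrt hr.le, heq t]
      rw [hb]
      field_simp
      linarith
    have e5 : (Real.sqrt r : ℂ) * (deriv (deriv q) t + (ν : ℂ) ^ 2 * q t) = b * ν * y t := by
      exact_mod_cast e3
    simp only [hg]
    linear_combination e5 - ((Real.sqrt r : ℂ) * ν ^ 2 * q t - b * ν * y t) * Complex.I_sq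
  -- Both sides solve the same linear equation, so that their difference is a multiple of `e^{iνt}`.
  set z : ℝ → ℂ := amplitude (fun _ => b) (fun _ => g 0) (deriv y) ν with hz
  have hd : ∀ t,
      HasDerivAt (fun t : ℝ => Complex.exp (-(Complex.I * ν * t)) * (g t - z t)) 0 t := by
    intro t
    have e1 : HasDerivAt (fun t : ℝ => Complex.exp (-(Complex.I * ν * t)))
        (Complex.exp (-(Complex.I * ν * t)) * (-(Complex.I * ν))) t := by
      have := (((hasDerivAt_id (t : ℂ)).const_mul (Complex.I * ν)).neg.cexp).comp_ofReal
      simpa using this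
    refine (e1.mul ((hgd t).sub (hasDerivAt_amplitude hx' ν t))).congr_deriv ?_
    change Complex.exp (-(Complex.I * ν * t)) * (-(Complex.I * ν)) * (g t - z t)
      + Complex.exp (-(Complex.I * ν * t)) * (Complex.I * ν * g t - Complex.I * b * deriv y t
        - (Complex.I * ν * z t - Complex.I * b * deriv y t)) = 0
    ring
  have hconst := is_const_of_deriv_eq_zero (fun t => (hd t).differentiableAt)
    (fun t => (hd t).deriv) t 0
  have hz0 : z 0 = g 0 := by simp [hz, amplitude, truncFourier]
  rw [hz0, sub_self, mul_zero] at hconst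
  exact sub_eq_zero.1 ((mul_eq_zero.1 hconst).resolve_left (Complex.exp_ne_zero _))

/-- A solution of the full system with threshold frequency zero is a reduced motion. -/
lemma isReducedMotion_of_isSolution (h1 : H1 ρ κ V₀) (h2 : H2 ρ κ) (h3 : H3 ρ κ V₀)
    (h4 : H4 ρ ξ₀ ξ₁) (h5 : H5 ρ κ) (hT : T ρ κ 0)
    (hsol : IsSolution ρ κ V₀ x₀ x₁ ξ₀ ξ₁ x ξ) :
    IsReducedMotion (coupling ρ κ) (initialAmplitude ρ κ x₀ ξ₀ ξ₁)
      (effectivePotential ρ κ V₀) x := by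
  have ha : ∀ ν ≠ 0, 0 < aHat ρ κ ν := fun ν hν => hT.aHat_pos ν (abs_pos.2 hν)
  have hV := contDiff_effectivePotential (κ := κ) h1
  refine
    { memLp_coupling := memLp_coupling h1 h2 h5
      continuousOn_coupling := h5.differentiable.continuous.continuousOn.div continuousOn_id
        fun ν hν => hν
      coupling_ne_zero := fun ν hν => div_ne_zero (ha ν hν).ne' hν
      memLp_initial := memLp_initialAmplitude h1 h2 h4 h5 x₀
      differentiable_potential := hV.differentiable (by simp)
      continuous_deriv_potential := hV.continuous_deriv (by simp)
      bddBelow := h3.bddBelow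
      isCompact_sublevel := h3.compact
      differentiable := hsol.differentiable
      differentiable_deriv := hsol.differentiable_deriv
      equation := fun t => ?_ }
  have hK : Integrable fun ν => coupling ρ κ ν ^ 2 := (memLp_coupling h1 h2 h5).integrable_sq
  have hKeq : K ρ κ = ∫ ν, coupling ρ κ ν ^ 2 := by simp only [K, coupling_sq h1]
  have hae : ∀ᵐ ν : ℝ, κ ν * ξ ν t - coupling ρ κ ν ^ 2 * x t = coupling ρ κ ν
      * (amplitude (coupling ρ κ) (initialAmplitude ρ κ x₀ ξ₀ ξ₁) (deriv x) ν t).im := by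
    filter_upwards [hsol.thermostat, hsol.initial_thermostat, Measure.ae_ne volume (0 : ℝ)]
      with ν hν hi hν0
    have hr : 0 < Real.sqrt (ρ ν) := by
      refine lt_of_le_of_ne (Real.sqrt_nonneg _) fun h0 => ?_
      have := ha ν hν0
      simp [aHat, ← h0] at this
    have hmode := amplitude_eq_of_mode (b := coupling ρ κ ν) (Real.sqrt_pos.1 hr) hν0 rfl
      hsol.differentiable hsol.differentiable_deriv.continuous hν.1 hν.2.1 hν.2.2 t
    rw [hi.1, hi.2, hsol.initial_oscillator.1] at hmode
    have hamp : amplitude (coupling ρ κ) (initialAmplitude ρ κ x₀ ξ₀ ξ₁) (deriv x) ν t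
        = (Real.sqrt (ρ ν) : ℂ) * (deriv (ξ ν) t + Complex.I * ν * ξ ν t)
          - Complex.I * coupling ρ κ ν * x t := hmode.symm
    have him : (amplitude (coupling ρ κ) (initialAmplitude ρ κ x₀ ξ₀ ξ₁) (deriv x) ν t).im
        = Real.sqrt (ρ ν) * (ν * ξ ν t) - coupling ρ κ ν * x t := by
      rw [hamp]; simp
    have hκ : κ ν = coupling ρ κ ν * Real.sqrt (ρ ν) * ν := by
      rw [coupling, aHat]; field_simp
    rw [him]
    linear_combination (ξ ν t) * hκ
  rw [← integral_congr_ae hae, integral_sub (hsol.integrable_force t) (hK.mul_const _),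
    integral_mul_const, ← hsol.oscillator t, ← hKeq, deriv_effectivePotential h1]
  ring

end Elimination

end Thermostat

theorem theorem5 (ρ κ V₀ : ℝ → ℝ) (ν₀ : ℝ) (x₀ x₁ : ℝ) (ξ₀ ξ₁ : ℝ → ℝ)
    (h1 : Thermostat.H1 ρ κ V₀) (h2 : Thermostat.H2 ρ κ) (h3 : Thermostat.H3 ρ κ V₀)
    (h4 : Thermostat.H4 ρ ξ₀ ξ₁) (h5 : Thermostat.H5 ρ κ)
    (hT : Thermostat.T ρ κ ν₀) (hν₀ : ν₀ = 0)
    (hcrit : ∀ a b : ℝ, a < b →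
      ∃ y ∈ Set.Ioo a b, deriv (Thermostat.effectivePotential ρ κ V₀) y ≠ 0)
    (x : ℝ → ℝ) (ξ : ℝ → ℝ → ℝ)
    (hsol : Thermostat.IsSolution ρ κ V₀ x₀ x₁ ξ₀ ξ₁ x ξ) :
    ∃ xPlus xMinus : ℝ,
      Filter.Tendsto x Filter.atTop (nhds xPlus) ∧
      Filter.Tendsto x Filter.atBot (nhds xMinus) ∧
      deriv (Thermostat.effectivePotential ρ κ V₀) xPlus = 0 ∧
      deriv (Thermostat.effectivePotential ρ κ V₀) xMinus = 0 := by
  subst hν₀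
  exact (Thermostat.isReducedMotion_of_isSolution h1 h2 h3 h4 h5 hT hsol).exists_tendsto hcrit
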